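/- For a finite group $G$ let $o(G)=\frac{1}{|G|}\sum_{x\in G} o(x)$ denote the average order of $G$, where $o(x)$ is the order of the element $x$. Let $C_n$ be the cyclic group of order $n$, let $C_2^k$ be the direct product of $k$ copies of $C_2$, and let $D_8$ be the dihedral group of order $8$. For an abelian group $A$ let $D(A)=A\rtimes C_2$ be the generalized dihedral group, in which the generator of $C_2$ acts on $A$ by inversion. Let $D_8*D_8$ be the central product of two copies of $D_8$, that is, the quotient of $D_8\times D_8$ by $\{(z,z^{-1}) : z\in Z(D_8)\}$. Finally, let $$S(2)=\langle c,x_1,y_1,x_2,y_2 \mid c^2=x_i^2=y_i^2=e,\ [c,x_i]=y_i\ (i=1,2),\ \text{all other pairs of generators commute}\rangle .$$ Theorem. Let $G$ be a finite $2$-group with $o(G)<2.8$. Then $G$ is isomorphic to one of the following groups, where $k\ge 0$ is an integer: (i) $C_4$; (ii) $D_8\times C_2^k$; (iii) $D(C_4\times C_4)\times C_2^k$; (iv) $(D_8*D_8)\times C_2^k$; (v) $S(2)\times C_2^k$; (vi) an elementary abelian $2$-group, i.e. $C_2^k$. -/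

import Mathlib

noncomputable section

namespace AverageOrder

open scoped commutatorElement

/-- The average order `o(G) = (∑ x, o(x)) / |G|` of a finite group. -/
def avgOrder (G : Type*) [Group G] [Fintype G] : ℚ :=
  (∑ x : G, (orderOf x : ℚ)) / (Fintype.card G : ℚ)

/-- The cyclic group of order `n` (for `n ≠ 0`), written multiplicatively. -/
abbrev Cyc (n : ℕ) : Type := Multiplicative (ZMod n)

/-- The direct product of `k` copies of the cyclic group of order `2`. -/
abbrev CycTwoPow (k : ℕ) : Type := Fin k → Cyc 2

/-- The action of the cyclic group of order two on an abelian group in which the generator acts by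
inversion. -/
def invAction (A : Type*) [CommGroup A] : Cyc 2 →* MulAut A where
  toFun t := if t = 1 then 1 else MulEquiv.inv A
  map_one' := by simp
  map_mul' s t := by
    have h : ∀ u : Cyc 2, u = 1 ∨ u = Multiplicative.ofAdd 1 := by decide
    have h1 : (Multiplicative.ofAdd 1 : Cyc 2) ≠ 1 := by decide
    have h2 : (Multiplicative.ofAdd 1 * Multiplicative.ofAdd 1 : Cyc 2) = 1 := by decide
    rcases h s with rfl | rfl <;> rcases h t with rfl | rfl
    · simp
    · simp
    · simp
    · rw [h2, if_pos rfl, if_neg h1]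
      ext a
      simp

/-- The generalized dihedral group `D(A) = A ⋊ C₂` of an abelian group `A`. -/
abbrev GenDihedral (A : Type*) [CommGroup A] : Type _ := A ⋊[invAction A] Cyc 2

/-- The subgroup `{(z, θ(z)⁻¹) : z ∈ Z(G)}` of `G × H`, for an isomorphism `θ : Z(G) ≃ Z(H)`. -/
def amalgam {G H : Type*} [Group G] [Group H]
    (θ : Subgroup.center G ≃* Subgroup.center H) : Subgroup (G × H) where
  carrier := {p | ∃ z : Subgroup.center G, p = ((z : G), ((θ z)⁻¹ : Subgroup.center H).1)}
  one_mem' := ⟨1, by rw [map_one, inv_one]; rfl⟩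
  mul_mem' := by
    rintro _ _ ⟨z, rfl⟩ ⟨w, rfl⟩
    refine ⟨z * w, ?_⟩
    have h : (θ z)⁻¹ * (θ w)⁻¹ = (θ (z * w))⁻¹ := by
      rw [map_mul, mul_inv_rev]
      exact Subtype.ext (Subgroup.mem_center_iff.1 ((θ w)⁻¹).2 _)
    rw [← h]
    rfl
  inv_mem' := by
    rintro _ ⟨z, rfl⟩
    refine ⟨z⁻¹, ?_⟩
    rw [map_inv]
    rfl

instance amalgam_normal {G H : Type*} [Group G] [Group H]
    (θ : Subgroup.center G ≃* Subgroup.center H) : (amalgam θ).Normal where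
  conj_mem := by
    rintro _ ⟨z, rfl⟩ ⟨g, h⟩
    refine ⟨z, ?_⟩
    have hz := Subgroup.mem_center_iff.1 z.2 g
    have hw := Subgroup.mem_center_iff.1 ((θ z)⁻¹ : Subgroup.center H).2 h
    refine Prod.ext ?_ ?_
    · change g * (z : G) * g⁻¹ = z
      rw [hz, mul_inv_cancel_right]
    · change h * ((θ z)⁻¹ : Subgroup.center H).1 * h⁻¹ = ((θ z)⁻¹ : Subgroup.center H).1
      rw [hw, mul_inv_cancel_right]

/-- The central product of `G` and `H`, with centres identified along `θ`. -/
abbrev CentralProduct {G H : Type*} [Group G] [Group H]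
    (θ : Subgroup.center G ≃* Subgroup.center H) : Type _ := (G × H) ⧸ amalgam θ

/-- The central product `D₈ * D₈` of two dihedral groups of order `8`. Their centres have order
two, so there is only one way to identify them. -/
abbrev D8CentralD8 : Type :=
  CentralProduct (MulEquiv.refl (Subgroup.center (DihedralGroup 4)))

/-- The generators `c, x₁, y₁, …, x_r, y_r` of `S(r)`. -/
inductive SGen (r : ℕ) : Type
  | c : SGen r
  | x : Fin r → SGen r
  | y : Fin r → SGen r

/-- The relators of `S(r)`: the generators square to the identity, `[c, x_i] = y_i`, and all other
pairs of generators commute. -/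
inductive SRel (r : ℕ) : FreeGroup (SGen r) → Prop
  | sq (g : SGen r) : SRel r (FreeGroup.of g ^ 2)
  | comm_c_x (i : Fin r) :
      SRel r (⁅FreeGroup.of (SGen.c : SGen r), FreeGroup.of (SGen.x i)⁆ * (FreeGroup.of (SGen.y i))⁻¹)
  | comm_c_y (i : Fin r) : SRel r ⁅FreeGroup.of (SGen.c : SGen r), FreeGroup.of (SGen.y i)⁆
  | comm_x_x (i j : Fin r) : SRel r ⁅FreeGroup.of (SGen.x i), FreeGroup.of (SGen.x j)⁆
  | comm_x_y (i j : Fin r) : SRel r ⁅FreeGroup.of (SGen.x i), FreeGroup.of (SGen.y j)⁆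
  | comm_y_y (i j : Fin r) : SRel r ⁅FreeGroup.of (SGen.y i), FreeGroup.of (SGen.y j)⁆

/-- The group `S(r)` given by the above generators and relators. -/
abbrev SGroup (r : ℕ) : Type := PresentedGroup {w : FreeGroup (SGen r) | SRel r w}

end AverageOrder

end

/-! Write `I` for the set of elements with square 1 and call `|I ∩ H| / |H|` the density of a
subgroup `H`. In a 2-group an element outside `I` has order at least 4, and order at least 8 if its
fourth power is not 1. Hence average order below 14/5 makes the density of `G` exceed 3/5, up to an
error of `1/(2|G|)`. Density at most 9/16 then survives only in very small groups, where `C₄` is the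
one that is not elementary abelian. From here on the density exceeds 9/16.

If `t ∈ I` does not commute with `u`, then `u` and `t * u` are not both in `I`. So at most half of
the complement of the centralizer `C` of `t` lies in `I`, and in a 2-group the index of `C` is 1, 2
or 4. A second tool is used throughout: a subgroup containing more than half of a group is the whole
group, so a property that defines a subgroup need only be checked on `I`.

If all indices are at most 2, commutators and squares lie in a central subgroup `{1, z}`
(`exists_isClassTwo`). Two noncommuting involutions split off a `D₈`, and the excess of the density
over 1/2 at least doubles on passing to their common centralizer. An excess above 1/16 permits at
most two such splittings, which gives `D₈` or `D₈ * D₈` times an elementary abelian group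
(`IsClassTwo.classification`).

If some `t` has index 4, then `C` is elementary abelian and each of the other three cosets of `C`
contains an involution. Unless all conjugates of `t` by involutions lie in `C`, too many elements
have order at least 8. Otherwise let `x`, `y` be involutions in two different nontrivial cosets.
Half of `C` is central, it generates `G` together with `t`, `x`, `y`, and `(x * y)²` is either 1 or
`[t,x][t,y]`. The first case gives `S(2)`, the second `D(C₄ × C₄)`, each times an elementary abelian
group (`IsNormalIndexFour.classification`). -/

noncomputable section

namespace AverageOrder

open scoped commutatorElement

/-- The elements of a group that square to the identity. -/
def sqOne (G : Type*) [Group G] : Set G := {x | x * x = 1}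

/-! ### Counting elements of square one -/

section counting

variable {G : Type*} [Group G]

lemma mem_sqOne {x : G} : x ∈ sqOne G ↔ x * x = 1 := Iff.rfl

lemma inv_eq_of_mem_sqOne {x : G} (hx : x ∈ sqOne G) : x⁻¹ = x :=
  inv_eq_of_mul_eq_one_left hx

lemma mul_mul_cancel_of_mem_sqOne {x : G} (hx : x ∈ sqOne G) (g : G) : x * (x * g) = g := by
  rw [← mul_assoc, mem_sqOne.1 hx, one_mul]

lemma mul_mem_sqOne {x y : G} (hx : x ∈ sqOne G) (hy : y ∈ sqOne G) (h : x * y = y * x) :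
    x * y ∈ sqOne G := by
  rw [mem_sqOne] at *
  rw [mul_assoc, ← mul_assoc y, ← h, mul_assoc x y y, hy, mul_one, hx]

lemma commute_of_mul_mem_sqOne {x y : G} (hx : x ∈ sqOne G) (hy : y ∈ sqOne G)
    (h : x * y ∈ sqOne G) : x * y = y * x := by
  have h1 := inv_eq_of_mem_sqOne h
  rw [mul_inv_rev, inv_eq_of_mem_sqOne hx, inv_eq_of_mem_sqOne hy] at h1
  exact h1.symm

lemma mem_centralizer_self (t : G) : t ∈ Subgroup.centralizer {t} :=
  Subgroup.mem_centralizer_singleton_iff.2 rfl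

lemma ncard_sqOne_subgroup (H : Subgroup G) :
    (sqOne H).ncard = ((H : Set G) ∩ sqOne G).ncard := by
  rw [← Set.ncard_image_of_injective _ H.subtype_injective]
  congr 1
  ext x
  constructor
  · rintro ⟨y, hy, rfl⟩
    exact ⟨y.2, congrArg Subtype.val hy⟩
  · rintro ⟨hx, hx'⟩
    exact ⟨⟨x, hx⟩, Subtype.ext hx', rfl⟩

variable [Finite G]

/-- Two elements `u`, `t * u` of square one force `u` to commute with `t`. So left multiplication by
`t` carries `U ∩ sqOne G` injectively into the rest of `U`. -/
lemma two_mul_ncard_sqOne_inter_le {t : G} (ht : t ∈ sqOne G) (U : Set G)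
    (hU : ∀ u ∈ U, u * t ≠ t * u) (hinv : ∀ u ∈ U, t * u ∈ U) :
    2 * (U ∩ sqOne G).ncard ≤ U.ncard := by
  have hinj : Function.Injective (t * · : G → G) := mul_right_injective t
  have h1 : ((t * ·) '' (U ∩ sqOne G)).ncard = (U ∩ sqOne G).ncard :=
    Set.ncard_image_of_injective _ hinj
  have hd : Disjoint (U ∩ sqOne G) ((t * ·) '' (U ∩ sqOne G)) := by
    rw [Set.disjoint_left]
    rintro _ hx ⟨y, hy, rfl⟩
    exact hU y hy.1 (commute_of_mul_mem_sqOne ht hy.2 hx.2).symm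
  have h2 := Set.ncard_union_eq hd (Set.toFinite _) (Set.toFinite _)
  have h3 : (U ∩ sqOne G) ∪ ((t * ·) '' (U ∩ sqOne G)) ⊆ U := by
    rintro _ (hx | ⟨y, hy, rfl⟩)
    · exact hx.1
    · exact hinv y hy.1
  have h4 := Set.ncard_le_ncard h3 (Set.toFinite _)
  omega

/-- The previous bound for the complement of the centralizer. It limits the index of the centralizer
when the density is large, and forces high density on the centralizer. -/
lemma two_mul_ncard_sqOne_add_card_centralizer_le {t : G} (ht : t ∈ sqOne G) :
    2 * (sqOne G).ncard + Nat.card (Subgroup.centralizer {t}) ≤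
      Nat.card G + 2 * ((Subgroup.centralizer {t} : Set G) ∩ sqOne G).ncard := by
  set C : Set G := (Subgroup.centralizer {t} : Set G) with hC
  have h1 : 2 * (Cᶜ ∩ sqOne G).ncard ≤ Cᶜ.ncard := by
    refine two_mul_ncard_sqOne_inter_le ht _ ?_ ?_
    · intro u hu h
      exact hu (Subgroup.mem_centralizer_singleton_iff.2 h)
    · intro u hu h
      exact hu ((Subgroup.mul_mem_cancel_left _ (mem_centralizer_self t)).1 h)
  have h2 := Set.ncard_add_ncard_compl C
  have h3 : (C ∩ sqOne G).ncard + (Cᶜ ∩ sqOne G).ncard = (sqOne G).ncard := by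
    rw [Set.inter_comm C, Set.inter_comm Cᶜ, ← Set.sdiff_eq]
    exact Set.ncard_inter_add_ncard_sdiff_eq_ncard _ _ (Set.toFinite _)
  have h4 : Nat.card (Subgroup.centralizer {t}) = C.ncard := rfl
  omega

lemma ncard_inter_sqOne_le_card (H : Subgroup G) :
    ((H : Set G) ∩ sqOne G).ncard ≤ Nat.card H :=
  Set.ncard_le_ncard Set.inter_subset_left (Set.toFinite _)

/-- `H ⊓ K` contains more than half of `H`, so Lagrange makes it equal to `H`. -/
lemma le_of_inter_sqOne_subset {H K : Subgroup G}
    (h : Nat.card H < 2 * ((H : Set G) ∩ sqOne G).ncard)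
    (hK : (H : Set G) ∩ sqOne G ⊆ K) : H ≤ K := by
  have h1 : ((H : Set G) ∩ sqOne G).ncard ≤ Nat.card (H ⊓ K : Subgroup G) :=
    Set.ncard_le_ncard (fun x hx => ⟨hx.1, hK hx⟩) (Set.toFinite _)
  obtain ⟨m, hm⟩ := Subgroup.card_dvd_of_le (inf_le_left : H ⊓ K ≤ H)
  have h2 : 0 < Nat.card H := Nat.card_pos
  have hm1 : m = 1 := by
    rcases m with _ | _ | m
    · omega
    · rfl
    · nlinarith
  rw [hm1, mul_one] at hm
  have := Subgroup.eq_of_le_of_card_ge (inf_le_left : H ⊓ K ≤ H) hm.le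
  exact inf_eq_left.1 this

lemma eq_top_of_sqOne_subset {K : Subgroup G} (h : Nat.card G < 2 * (sqOne G).ncard)
    (hK : sqOne G ⊆ K) : K = ⊤ := by
  rw [eq_top_iff]
  refine le_of_inter_sqOne_subset ?_ ?_
  · simpa using h
  · simpa using hK

/-- When its members commute, `H ∩ sqOne G` is itself a subgroup, and it contains more than half of
`H`. -/
lemma subset_sqOne_of_commute {H : Subgroup G}
    (h : Nat.card H < 2 * ((H : Set G) ∩ sqOne G).ncard)
    (hc : ∀ s ∈ H, ∀ t ∈ H, s ∈ sqOne G → t ∈ sqOne G → s * t = t * s) :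
    ∀ x ∈ H, x ∈ sqOne G := by
  let K : Subgroup G :=
    { carrier := (H : Set G) ∩ sqOne G
      one_mem' := ⟨H.one_mem, mul_one 1⟩
      mul_mem' := fun {a b} ha hb =>
        ⟨H.mul_mem ha.1 hb.1, mul_mem_sqOne ha.2 hb.2 (hc a ha.1 b hb.1 ha.2 hb.2)⟩
      inv_mem' := fun {a} ha => by
        rw [inv_eq_of_mem_sqOne ha.2]
        exact ha }
  have hK : H ≤ K := le_of_inter_sqOne_subset h fun x hx => hx
  exact fun x hx => (hK hx).2

lemma eq_top_of_card_lt {K : Subgroup G} (h : Nat.card G < 2 * Nat.card K) : K = ⊤ := by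
  obtain ⟨m, hm⟩ := Subgroup.card_subgroup_dvd_card K
  have h2 : 0 < Nat.card G := Nat.card_pos
  have hm1 : m = 1 := by
    rcases m with _ | _ | m
    · omega
    · rfl
    · nlinarith
  rw [hm1, mul_one] at hm
  exact Subgroup.eq_top_of_card_eq K hm.symm

/-- Density above 3/4 makes the centralizer of each involution larger than half of the group, so all
involutions are central. -/
lemma mem_sqOne_of_three_mul_card_lt (h : 3 * Nat.card G < 4 * (sqOne G).ncard) (x : G) :
    x ∈ sqOne G := by
  have hc : ∀ t ∈ sqOne G, Subgroup.centralizer {t} = ⊤ := fun t ht => by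
    apply eq_top_of_card_lt
    have h1 := two_mul_ncard_sqOne_add_card_centralizer_le ht
    have h2 := ncard_inter_sqOne_le_card (Subgroup.centralizer {t})
    omega
  refine subset_sqOne_of_commute (H := ⊤) ?_ ?_ x trivial
  · simp
    omega
  · intro s _ t _ _ ht
    have : s ∈ Subgroup.centralizer {t} := by rw [hc t ht]; trivial
    exact Subgroup.mem_centralizer_singleton_iff.1 this

lemma subset_sqOne_of_three_mul_card_lt {H : Subgroup G}
    (h : 3 * Nat.card H < 4 * ((H : Set G) ∩ sqOne G).ncard) : ∀ x ∈ H, x ∈ sqOne G := by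
  rw [← ncard_sqOne_subgroup] at h
  intro x hx
  exact congrArg Subtype.val (mem_sqOne_of_three_mul_card_lt h ⟨x, hx⟩)

lemma card_eq_two_mul {H K : Subgroup G} (hKH : K ≤ H) {a : G} (haH : a ∈ H) (haK : a ∉ K)
    (h : ∀ x ∈ H, x ∈ K ∨ a * x ∈ K) : Nat.card H = 2 * Nat.card K := by
  have hU : (H : Set G) = (K : Set G) ∪ (a⁻¹ * ·) '' (K : Set G) := by
    ext x
    constructor
    · intro hx
      rcases h x hx with h | h
      · exact Or.inl h
      · exact Or.inr ⟨a * x, h, by simp⟩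
    · rintro (hx | ⟨y, hy, rfl⟩)
      · exact hKH hx
      · exact H.mul_mem (H.inv_mem haH) (hKH hy)
  have hd : Disjoint (K : Set G) ((a⁻¹ * ·) '' (K : Set G)) := by
    rw [Set.disjoint_left]
    rintro _ hx ⟨y, hy, rfl⟩
    exact haK (by simpa using (K.mul_mem_cancel_right hy).1 hx)
  have h1 := Set.ncard_union_eq hd (Set.toFinite _) (Set.toFinite _)
  rw [← hU, Set.ncard_image_of_injective _ (mul_right_injective _)] at h1
  change (H : Set G).ncard = 2 * (K : Set G).ncard
  omega

end counting

/-! ### Homomorphisms out of the model groups, and splitting off elementary abelian factors -/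

section models

variable {G : Type*} [Group G]

lemma pow_two_of_mem_sqOne {x : G} (hx : x ∈ sqOne G) : x ^ 2 = 1 := (pow_two x).trans hx

/-- A subgroup of a finite elementary abelian `2`-group has a complement. -/
lemma exists_elementary_complement [Finite G] {Z W : Subgroup G} (hWZ : W ≤ Z)
    (hsq : ∀ x ∈ Z, x ∈ sqOne G) :
    ∃ k : ℕ, ∃ e : CycTwoPow k →* G, (∀ v, e v ∈ Z) ∧ (∀ x ∈ Z, ∃ w ∈ W, ∃ v, x = w * e v) ∧
      Nat.card Z = Nat.card W * 2 ^ k := by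
  let _ : CommGroup Z :=
    { (inferInstance : Group Z) with
      mul_comm := fun a b => Subtype.ext (commute_of_mul_mem_sqOne (hsq _ a.2) (hsq _ b.2)
        (hsq _ (a * b).2)) }
  let _ : Module (ZMod 2) (Additive Z) := AddCommGroup.zmodModule (n := 2) fun x => by
    rw [two_nsmul]
    exact Subtype.ext (hsq _ (x.toMul).2)
  let W' : Submodule (ZMod 2) (Additive Z) :=
    AddSubgroup.toZModSubmodule 2 (Subgroup.toAddSubgroup (W.subgroupOf Z))
  obtain ⟨E, hE⟩ := Submodule.exists_isCompl W'
  let b := (Module.finBasis (ZMod 2) E).equivFun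
  let e : CycTwoPow (Module.finrank (ZMod 2) E) →* G :=
    { toFun := fun v => ((b.symm fun i => (v i).toAdd : E) : Additive Z).toMul
      map_one' := by
        have : (fun i => ((1 : CycTwoPow (Module.finrank (ZMod 2) E)) i).toAdd) = 0 := rfl
        rw [this, map_zero]
        rfl
      map_mul' := fun v w => by
        have : (fun i => ((v * w) i).toAdd) = (fun i => (v i).toAdd) + fun i => (w i).toAdd := rfl
        rw [this, map_add]
        rfl }
  refine ⟨_, e, fun v => ((b.symm fun i => (v i).toAdd : E) : Additive Z).toMul.2, ?_, ?_⟩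
  · intro x hx
    have h : (Additive.ofMul (⟨x, hx⟩ : Z)) ∈ W' ⊔ E := by rw [hE.sup_eq_top]; trivial
    obtain ⟨w, hw, u, hu, hwu⟩ := Submodule.mem_sup.1 h
    refine ⟨(w.toMul : Z), hw, fun i => Multiplicative.ofAdd (b ⟨u, hu⟩ i), ?_⟩
    have h2 : e (fun i => Multiplicative.ofAdd (b ⟨u, hu⟩ i)) = (u.toMul : Z) := by
      change (((b.symm (b ⟨u, hu⟩) : E) : Additive Z).toMul : G) = _
      rw [LinearEquiv.symm_apply_apply]
    rw [h2]
    exact (congrArg (fun y : Additive Z => (y.toMul : G)) hwu).symm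
  · have h1 : Nat.card Z = Nat.card W' * Nat.card E := by
      rw [← Nat.card_prod]
      exact (Nat.card_congr (Submodule.prodEquivOfIsCompl W' E hE).toEquiv).symm
    have h2 : Nat.card W' = Nat.card W := Nat.card_congr (Subgroup.subgroupOfEquivOfLe hWZ).toEquiv
    have h3 : Nat.card E = 2 ^ Module.finrank (ZMod 2) E := by
      rw [Nat.card_congr b.toEquiv, Nat.card_fun]
      simp
    rw [h1, h2, h3]

/-- With `E` a complement of `W` in `Z`, the map `P × E → G` is surjective, and `hcard` says that
its source is no larger than `G`. Injectivity of `f` is a consequence, so for each model group only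
an upper bound on the order is needed. -/
lemma exists_mulEquiv_prod [Finite G] {P : Type*} [Group P] [Finite P] {Z W : Subgroup G}
    (f : P →* G) (hWZ : W ≤ Z) (hW : W ≤ f.range) (hsq : ∀ x ∈ Z, x ∈ sqOne G)
    (hcomm : ∀ p, ∀ z ∈ Z, f p * z = z * f p) (htop : f.range ⊔ Z = ⊤)
    (hcard : Nat.card P * Nat.card Z ≤ Nat.card G * Nat.card W) :
    ∃ k : ℕ, Nonempty (G ≃* P × CycTwoPow k) := by
  obtain ⟨k, e, heZ, hex, hk⟩ := exists_elementary_complement hWZ hsq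
  let F : P × CycTwoPow k →* G := f.noncommCoprod e fun p v => hcomm p _ (heZ v)
  have h1 : f.range ≤ F.range := by
    rintro _ ⟨p, rfl⟩
    exact ⟨(p, 1), show f p * e 1 = f p by rw [map_one, mul_one]⟩
  have h2 : Z ≤ F.range := by
    intro z hz
    obtain ⟨w, hw, v, rfl⟩ := hex z hz
    exact F.range.mul_mem (h1 (hW hw)) ⟨(1, v), show f 1 * e v = e v by rw [map_one, one_mul]⟩
  have hsurj : Function.Surjective F := by
    rw [← MonoidHom.range_eq_top, eq_top_iff, ← htop]
    exact sup_le h1 h2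
  have h3 : Nat.card (P × CycTwoPow k) ≤ Nat.card G := by
    have hW0 : 0 < Nat.card W := Nat.card_pos
    have h4 : Nat.card (CycTwoPow k) = 2 ^ k := by
      rw [Nat.card_fun]
      simp
    rw [Nat.card_prod, h4]
    rw [hk] at hcard
    nlinarith
  exact ⟨k, ⟨(MulEquiv.ofBijective F (hsurj.bijective_of_nat_card_le h3)).symm⟩⟩

/-- The homomorphism from a cyclic group determined by the image of the generator. -/
def cycHom {n : ℕ} (a : G) (ha : a ^ n = 1) : Cyc n →* G :=
  AddMonoidHom.toMultiplicativeLeft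
    (ZMod.lift n ⟨zmultiplesHom (Additive G) (Additive.ofMul a), by
      simpa [← ofMul_pow] using ha⟩)

lemma cycHom_intCast {n : ℕ} (a : G) (ha : a ^ n = 1) (i : ℤ) :
    cycHom a ha (Multiplicative.ofAdd (i : ZMod n)) = a ^ i := by
  simp [cycHom]

lemma cycHom_one {n : ℕ} (a : G) (ha : a ^ n = 1) :
    cycHom a ha (Multiplicative.ofAdd (1 : ZMod n)) = a := by
  simpa using cycHom_intCast a ha 1

lemma exists_cycHom_eq {n : ℕ} (a : G) (ha : a ^ n = 1) (x : Cyc n) :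
    ∃ i : ℤ, cycHom a ha x = a ^ i := by
  obtain ⟨i, hi⟩ := ZMod.intCast_surjective x.toAdd
  exact ⟨i, by rw [← cycHom_intCast a ha, hi]; rfl⟩

lemma conj_cycHom {n : ℕ} {a s : G} (ha : a ^ n = 1) (h : s * a * s⁻¹ = a⁻¹) (x : Cyc n) :
    s * cycHom a ha x * s⁻¹ = cycHom a ha x⁻¹ := by
  obtain ⟨i, hi⟩ := exists_cycHom_eq a ha x
  rw [map_inv, hi, ← conj_zpow, h, inv_zpow]

/-- The homomorphism from a dihedral group determined by the images of two generators. -/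
def dihedralHom {n : ℕ} (a s : G) (ha : a ^ n = 1) (hs : s ∈ sqOne G) (h : s * a * s⁻¹ = a⁻¹) :
    DihedralGroup n →* G :=
  MonoidHom.mk'
    (fun x => match x with
      | .r i => cycHom a ha (Multiplicative.ofAdd i)
      | .sr i => s * cycHom a ha (Multiplicative.ofAdd i)) <| by
    have key : ∀ x : Cyc n, cycHom a ha x * s = s * cycHom a ha x⁻¹ := fun x => by
      rw [← inv_inv x, ← conj_cycHom ha h, inv_inv, inv_mul_cancel_right]
    rintro (i | i) (j | j)
    · simp only [DihedralGroup.r_mul_r, ofAdd_add, map_mul]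
    · simp only [DihedralGroup.r_mul_sr, ofAdd_sub, div_eq_inv_mul, map_mul]
      rw [← mul_assoc (cycHom a ha _) s, key, mul_assoc]
    · simp only [DihedralGroup.sr_mul_r, ofAdd_add, map_mul, mul_assoc]
    · simp only [DihedralGroup.sr_mul_sr, ofAdd_sub, div_eq_inv_mul, map_mul]
      rw [mul_assoc, ← mul_assoc _ s, key, mul_assoc, ← mul_assoc s s, mem_sqOne.1 hs, one_mul]

section dihedral

variable {n : ℕ} {a s : G} (ha : a ^ n = 1) (hs : s ∈ sqOne G) (h : s * a * s⁻¹ = a⁻¹)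

lemma dihedralHom_r_one : dihedralHom a s ha hs h (.r 1) = a := cycHom_one a ha

lemma dihedralHom_sr_zero : dihedralHom a s ha hs h (.sr 0) = s := by
  change s * cycHom a ha 1 = s
  rw [map_one, mul_one]

lemma dihedralHom_r (i : ℕ) : dihedralHom a s ha hs h (.r i) = a ^ i := by
  rw [← DihedralGroup.r_one_pow, map_pow, dihedralHom_r_one]

lemma dihedralHom_mem {H : Subgroup G} (haH : a ∈ H) (hsH : s ∈ H) (x : DihedralGroup n) :
    dihedralHom a s ha hs h x ∈ H := by
  have h1 : ∀ i : ZMod n, cycHom a ha (Multiplicative.ofAdd i) ∈ H := fun i => by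
    obtain ⟨j, hj⟩ := exists_cycHom_eq a ha (Multiplicative.ofAdd i)
    rw [hj]
    exact H.zpow_mem haH j
  rcases x with i | i
  · exact h1 i
  · exact H.mul_mem hsH (h1 i)

end dihedral

lemma natCard_D8CentralD8_le : Nat.card D8CentralD8 ≤ 32 := by
  set N := amalgam (MulEquiv.refl (Subgroup.center (DihedralGroup 4))) with hN
  have h1 : Nat.card (DihedralGroup 4 × DihedralGroup 4) = Nat.card D8CentralD8 * Nat.card N :=
    Subgroup.card_eq_card_quotient_mul_card_subgroup N
  rw [Nat.card_prod, DihedralGroup.nat_card] at h1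
  have h2 : Nat.card N ≠ 1 := by
    intro h
    have h3 : N = ⊥ := Subgroup.card_eq_one.1 h
    have hz : (DihedralGroup.r 2 : DihedralGroup 4) ∈ Subgroup.center (DihedralGroup 4) := by
      rw [Subgroup.mem_center_iff]
      decide
    have h4 : ((DihedralGroup.r 2 : DihedralGroup 4), (DihedralGroup.r 2 : DihedralGroup 4)⁻¹) ∈ N :=
      ⟨⟨_, hz⟩, rfl⟩
    rw [h3, Subgroup.mem_bot] at h4
    exact absurd (congrArg Prod.fst h4) (by decide)
  have h3 : 0 < Nat.card N := Nat.card_pos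
  have h4 : 2 ≤ Nat.card N := by omega
  nlinarith

lemma eq_one_or_of_mem_center {x : DihedralGroup 4} (hx : x ∈ Subgroup.center (DihedralGroup 4)) :
    x = 1 ∨ x = .r 2 := by
  rw [Subgroup.mem_center_iff] at hx
  revert x
  decide

/-- Commuting homomorphisms from `D₈` that agree on the centre induce one from `D₈ * D₈`. -/
def d8CentralD8Hom (f g : DihedralGroup 4 →* G) (hcomm : ∀ x y, Commute (f x) (g y))
    (hfg : f (.r 2) = g (.r 2)) : D8CentralD8 →* G :=
  QuotientGroup.lift _ (f.noncommCoprod g hcomm) <| by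
    rintro _ ⟨z, rfl⟩
    change f z * g ((z⁻¹ : Subgroup.center (DihedralGroup 4)) : DihedralGroup 4) = 1
    rw [Subgroup.coe_inv, map_inv, mul_inv_eq_one]
    rcases eq_one_or_of_mem_center z.2 with h | h <;> rw [h]
    · simp
    · exact hfg

lemma d8CentralD8Hom_mk (f g : DihedralGroup 4 →* G) (hcomm : ∀ x y, Commute (f x) (g y))
    (hfg : f (.r 2) = g (.r 2)) (x y : DihedralGroup 4) :
    d8CentralD8Hom f g hcomm hfg (QuotientGroup.mk (x, y)) = f x * g y := rfl

/-- The homomorphism from a generalized dihedral group determined by one on the abelian subgroup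
and an involution that inverts its image. -/
def genDihedralHom {A : Type*} [CommGroup A] (f : A →* G) (s : G) (hs : s ∈ sqOne G)
    (h : ∀ a, s * f a * s⁻¹ = f a⁻¹) : GenDihedral A →* G :=
  SemidirectProduct.lift f (cycHom s (pow_two_of_mem_sqOne hs)) <| by
    intro t
    have ht : t = 1 ∨ t = Multiplicative.ofAdd 1 := by revert t; decide
    rcases ht with rfl | rfl
    · ext; simp
    · have h1 : (Multiplicative.ofAdd 1 : Cyc 2) ≠ 1 := by decide
      ext a
      simp only [MonoidHom.comp_apply, MulEquiv.coe_toMonoidHom, MulAut.conj_apply, cycHom_one, h]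
      simp [invAction, h1]

lemma genDihedralHom_inl {A : Type*} [CommGroup A] (f : A →* G) (s : G) (hs : s ∈ sqOne G)
    (h : ∀ a, s * f a * s⁻¹ = f a⁻¹) (a : A) :
    genDihedralHom f s hs h (SemidirectProduct.inl a) = f a :=
  SemidirectProduct.lift_inl _ _ _ _

lemma genDihedralHom_inr {A : Type*} [CommGroup A] (f : A →* G) (s : G) (hs : s ∈ sqOne G)
    (h : ∀ a, s * f a * s⁻¹ = f a⁻¹) :
    genDihedralHom f s hs h (SemidirectProduct.inr (Multiplicative.ofAdd 1)) = s := by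
  rw [genDihedralHom, SemidirectProduct.lift_inr, cycHom_one]

instance (A : Type*) [CommGroup A] [Finite A] : Finite (GenDihedral A) :=
  Finite.of_equiv _ SemidirectProduct.equivProd.symm

lemma natCard_genDihedral (A : Type*) [CommGroup A] :
    Nat.card (GenDihedral A) = 2 * Nat.card A := by
  rw [Nat.card_congr SemidirectProduct.equivProd, Nat.card_prod, mul_comm]
  simp

section sgroup

/-- The homomorphism from `S(r)` determined by elements satisfying its relations. -/
def sGroupHom {r : ℕ} (v : SGen r → G) (hv : ∀ g, v g ∈ sqOne G)
    (hcx : ∀ i, v .c * v (.x i) * v .c * v (.x i) = v (.y i))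
    (hcy : ∀ i, v .c * v (.y i) = v (.y i) * v .c)
    (hxx : ∀ i j, v (.x i) * v (.x j) = v (.x j) * v (.x i))
    (hxy : ∀ i j, v (.x i) * v (.y j) = v (.y j) * v (.x i))
    (hyy : ∀ i j, v (.y i) * v (.y j) = v (.y j) * v (.y i)) : SGroup r →* G :=
  PresentedGroup.toGroup (f := v) <| by
    rintro _ (g | i | i | ⟨i, j⟩ | ⟨i, j⟩ | ⟨i, j⟩)
    · simpa using pow_two_of_mem_sqOne (hv g)
    · simp only [map_mul, map_inv, FreeGroup.lift_apply_of, commutatorElement_def,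
        inv_eq_of_mem_sqOne (hv _), hcx]
      exact hv _
    · simpa [commutatorElement_eq_one_iff_mul_comm] using hcy i
    · simpa [commutatorElement_eq_one_iff_mul_comm] using hxx i j
    · simpa [commutatorElement_eq_one_iff_mul_comm] using hxy i j
    · simpa [commutatorElement_eq_one_iff_mul_comm] using hyy i j

lemma mk_eq_one_of_sRel {r : ℕ} {w : FreeGroup (SGen r)} (h : SRel r w) :
    PresentedGroup.mk {w : FreeGroup (SGen r) | SRel r w} w = 1 :=
  PresentedGroup.one_of_mem h

/-- The generators of `S(r)`. -/
def sGen {r : ℕ} (g : SGen r) : SGroup r := PresentedGroup.of g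

variable {r : ℕ}

lemma sGen_sq (g : SGen r) : sGen g ^ 2 = 1 :=
  mk_eq_one_of_sRel (SRel.sq g)

lemma sGen_mul_y_c (i : Fin r) : Commute (sGen (.y i)) (sGen .c) :=
  (commutatorElement_eq_one_iff_commute.1 (mk_eq_one_of_sRel (SRel.comm_c_y i))).symm

lemma sGen_mul_x_x (i j : Fin r) : Commute (sGen (.x i)) (sGen (.x j)) :=
  commutatorElement_eq_one_iff_commute.1 (mk_eq_one_of_sRel (SRel.comm_x_x i j))

lemma sGen_mul_y_x (i j : Fin r) : Commute (sGen (.y i)) (sGen (.x j)) :=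
  (commutatorElement_eq_one_iff_commute.1 (mk_eq_one_of_sRel (SRel.comm_x_y j i))).symm

lemma sGen_mul_y_y (i j : Fin r) : Commute (sGen (.y i)) (sGen (.y j)) :=
  commutatorElement_eq_one_iff_commute.1 (mk_eq_one_of_sRel (SRel.comm_y_y i j))

lemma sGen_mul_x_c (i : Fin r) :
    sGen (.x i) * sGen .c = sGen .c * sGen (.x i) * sGen (.y i) := by
  have h : ⁅sGen (.c : SGen r), sGen (.x i)⁆ = sGen (.y i) :=
    mul_inv_eq_one.1 (mk_eq_one_of_sRel (SRel.comm_c_x i))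
  rw [commutatorElement_def, mul_inv_eq_iff_eq_mul, mul_inv_eq_iff_eq_mul] at h
  rw [h, mul_assoc (sGen (.y i)), ((sGen_mul_y_x i i).mul_right (sGen_mul_y_c i)).eq, mul_assoc _ _
    (sGen (.y i)), ← pow_two, sGen_sq, mul_one]

lemma sGen_x_mul_c_pow (i : Fin r) (a : ℕ) :
    sGen (.x i) * sGen .c ^ a = sGen .c ^ a * sGen (.x i) * sGen (.y i) ^ a := by
  induction a with
  | zero => simp
  | succ a ih =>
    rw [pow_succ, ← mul_assoc, ih, mul_assoc, ((sGen_mul_y_c i).pow_left a).eq, ← mul_assoc,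
      mul_assoc _ (sGen (.x i)), sGen_mul_x_c, ← mul_assoc, ← mul_assoc, mul_assoc _ (sGen (.y i)),
      ← pow_succ']

/-- The set of products in normal form is stable under left multiplication by generators: the `y`s
are central, and moving an `x` past a power of `c` costs only a power of a `y`. Uniqueness is not
needed. -/
lemma exists_sGroup_two_normalForm (g : SGroup 2) : ∃ a b₀ b₁ d₀ d₁ : ℕ,
    g = sGen .c ^ a * sGen (.x 0) ^ b₀ * sGen (.x 1) ^ b₁ * sGen (.y 0) ^ d₀ *
      sGen (.y 1) ^ d₁ := by
  let T : Set (SGroup 2) := {g | ∃ a b₀ b₁ d₀ d₁ : ℕ,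
    g = sGen .c ^ a * sGen (.x 0) ^ b₀ * sGen (.x 1) ^ b₁ * sGen (.y 0) ^ d₀ * sGen (.y 1) ^ d₁}
  have hy : ∀ i : Fin 2, ∀ h ∈ T, h * sGen (.y i) ∈ T := by
    rintro i _ ⟨a, b₀, b₁, d₀, d₁, rfl⟩
    fin_cases i
    · refine ⟨a, b₀, b₁, d₀ + 1, d₁, ?_⟩
      simp only [Fin.zero_eta, mul_assoc, pow_succ]
      rw [((sGen_mul_y_y 0 1).symm.pow_left d₁).eq]
    · refine ⟨a, b₀, b₁, d₀, d₁ + 1, ?_⟩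
      simp only [Fin.mk_one, mul_assoc, pow_succ]
  have hyc : ∀ i : Fin 2, ∀ g : SGroup 2, Commute (sGen (.y i)) g := fun i g => by
    have : g ∈ Subgroup.centralizer {sGen (.y i)} := by
      refine PresentedGroup.generated_by _ _ ?_ g
      rintro (_ | j | j) <;> rw [Subgroup.mem_centralizer_singleton_iff]
      · exact (sGen_mul_y_c i).eq.symm
      · exact (sGen_mul_y_x i j).eq.symm
      · exact (sGen_mul_y_y i j).eq.symm
    exact (Subgroup.mem_centralizer_singleton_iff.1 this).symm
  have hy' : ∀ i : Fin 2, ∀ n : ℕ, ∀ h ∈ T, h * sGen (.y i) ^ n ∈ T := fun i n => by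
    induction n with
    | zero => simp
    | succ n ih =>
      intro h hh
      rw [pow_succ, ← mul_assoc]
      exact hy i _ (ih h hh)
  have hx : ∀ i : Fin 2, ∀ h ∈ T, sGen (.x i) * h ∈ T := by
    rintro i _ ⟨a, b₀, b₁, d₀, d₁, rfl⟩
    have h1 : ∀ g : SGroup 2, sGen (.x i) * (sGen .c ^ a * g) =
        sGen .c ^ a * (sGen (.x i) * g) * sGen (.y i) ^ a := fun g => by
      rw [← mul_assoc, sGen_x_mul_c_pow, mul_assoc, ((hyc i g).pow_left a).eq]
      simp only [mul_assoc]
    simp only [mul_assoc]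
    rw [h1]
    refine hy' i a _ ?_
    fin_cases i
    · refine ⟨a, b₀ + 1, b₁, d₀, d₁, ?_⟩
      simp only [Fin.zero_eta, mul_assoc, pow_succ']
    · refine ⟨a, b₀, b₁ + 1, d₀, d₁, ?_⟩
      simp only [Fin.mk_one, mul_assoc, pow_succ']
      rw [← mul_assoc (sGen (.x 1)), ((sGen_mul_x_x 1 0).pow_right b₀).eq, mul_assoc]
  have hT : ∀ v : SGen 2, ∀ h ∈ T, sGen v * h ∈ T := by
    rintro (_ | i | i) h hh
    · obtain ⟨a, b₀, b₁, d₀, d₁, rfl⟩ := hh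
      exact ⟨a + 1, b₀, b₁, d₀, d₁, by simp only [mul_assoc, pow_succ']⟩
    · exact hx i h hh
    · rw [(hyc i h).eq]
      exact hy i h hh
  have hg : g ∈ Subgroup.closure (Set.range (sGen : SGen 2 → SGroup 2)) := by
    rw [show Set.range (sGen : SGen 2 → SGroup 2) = Set.range PresentedGroup.of from rfl,
      PresentedGroup.closure_range_of]
    trivial
  change g ∈ T
  induction hg using Subgroup.closure_induction_left with
  | one => exact ⟨0, 0, 0, 0, 0, by simp⟩
  | mul_left x hx y _ ih =>
    obtain ⟨v, rfl⟩ := hx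
    exact hT v y ih
  | inv_mul_cancel x hx y _ ih =>
    obtain ⟨v, rfl⟩ := hx
    rw [inv_eq_of_mul_eq_one_left ((pow_two _).symm.trans (sGen_sq v))]
    exact hT v y ih

lemma finite_sGroup_two : Finite (SGroup 2) ∧ Nat.card (SGroup 2) ≤ 32 := by
  let F : Fin 2 × Fin 2 × Fin 2 × Fin 2 × Fin 2 → SGroup 2 := fun p =>
    sGen .c ^ (p.1 : ℕ) * sGen (.x 0) ^ (p.2.1 : ℕ) * sGen (.x 1) ^ (p.2.2.1 : ℕ) *
      sGen (.y 0) ^ (p.2.2.2.1 : ℕ) * sGen (.y 1) ^ (p.2.2.2.2 : ℕ)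
  have hF : Function.Surjective F := by
    intro g
    obtain ⟨a, b₀, b₁, d₀, d₁, rfl⟩ := exists_sGroup_two_normalForm g
    refine ⟨(Fin.ofNat 2 a, Fin.ofNat 2 b₀, Fin.ofNat 2 b₁, Fin.ofNat 2 d₀, Fin.ofNat 2 d₁), ?_⟩
    simp only [F, Fin.val_ofNat, ← pow_eq_pow_mod _ (sGen_sq _)]
  refine ⟨Finite.of_surjective F hF, (Nat.card_le_card_of_surjective F hF).trans ?_⟩
  simp

end sgroup

end models

/-! ### All centralizers of involutions have index at most two -/

section classTwo

variable {G : Type*} [Group G]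

/-- If the class of `s` has at most two elements, then these differ by a central element of
order at most two. -/
lemma exists_central_of_class_le_two [Finite G] {s : G} (hs : s ∈ sqOne G)
    (hi : (Subgroup.centralizer {s}).index ≤ 2) :
    ∃ z ∈ sqOne G, (∀ h, h * z = z * h) ∧ ∀ h, h * s * h⁻¹ = s ∨ h * s * h⁻¹ = s * z := by
  by_cases hc : ∀ g, g * s = s * g
  · exact ⟨1, mul_one 1, by simp, fun h => Or.inl (by rw [hc, mul_inv_cancel_right])⟩
  push Not at hc
  obtain ⟨g, hg⟩ := hc
  have hg' : g ∉ Subgroup.centralizer {s} := fun h => hg (Subgroup.mem_centralizer_singleton_iff.1 h)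
  have h2 : (Subgroup.centralizer {s}).index = 2 := by
    have h0 := (Subgroup.centralizer {s}).index_ne_zero_of_finite
    have h1 : (Subgroup.centralizer {s}).index ≠ 1 := fun h => hg' (by
      rw [Subgroup.index_eq_one.1 h]; trivial)
    omega
  have key : ∀ h, h * s * h⁻¹ = s ∨ h * s * h⁻¹ = g * s * g⁻¹ := fun h => by
    by_cases hh : h ∈ Subgroup.centralizer {s}
    · left
      rw [Subgroup.mem_centralizer_singleton_iff.1 hh, mul_inv_cancel_right]
    · right
      have h3 : g⁻¹ * h ∈ Subgroup.centralizer {s} := by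
        rw [Subgroup.mul_mem_iff_of_index_two h2, inv_mem_iff]
        tauto
      have h4 := Subgroup.mem_centralizer_singleton_iff.1 h3
      rw [mul_inv_eq_iff_eq_mul, ← mul_right_inj g⁻¹]
      simpa [mul_assoc] using h4
  set u := g * s * g⁻¹ with hu
  have hus : u ∈ sqOne G := by
    rw [mem_sqOne, hu]
    simp [mul_assoc]
    rw [← mul_assoc s s, mem_sqOne.1 hs]
    simp
  have hne : u ≠ s := fun h => hg (by rwa [hu, mul_inv_eq_iff_eq_mul] at h)
  have hsu : s * u = u * s := by
    -- Conjugation by `s * g` sends `s` to `s * u * s⁻¹`, which is `s` or `u`; the value `s` would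
    -- give `u = s`.
    rcases key (s * g) with h | h
    · exact absurd (show u = s by
        have : u = s⁻¹ * (s * g * s * (s * g)⁻¹) * s := by rw [hu]; group
        rw [this, h]; group) hne
    · have : s * u = s * g * s * (s * g)⁻¹ * s := by rw [hu]; group
      rw [this, h]
  -- Conjugation permutes the class `{s, u}`, so it fixes the product `s * u`.
  refine ⟨s * u, mul_mem_sqOne hs hus hsu, fun h => ?_, fun h => ?_⟩
  · have h1 : h * u * h⁻¹ = s ∨ h * u * h⁻¹ = u := by
      have := key (h * g)
      rwa [show h * g * s * (h * g)⁻¹ = h * u * h⁻¹ by rw [hu]; group] at this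
    have h2 : h * s * h⁻¹ ≠ h * u * h⁻¹ := by
      simpa using hne.symm
    have h3 : h * (s * u) * h⁻¹ = (h * s * h⁻¹) * (h * u * h⁻¹) := by group
    rw [← mul_inv_eq_iff_eq_mul, h3]
    rcases key h with h4 | h4 <;> rcases h1 with h5 | h5
    · exact absurd (h4.trans h5.symm) h2
    · rw [h4, h5]
    · rw [h4, h5, hsu]
    · exact absurd (h4.trans h5.symm) h2
  · rw [← mul_assoc, mem_sqOne.1 hs, one_mul]
    exact key h

lemma conj_mul (h s t : G) : h * (s * t) * h⁻¹ = (h * s * h⁻¹) * (h * t * h⁻¹) := by group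

/-- If all classes of involutions have at most two elements and more than half of the elements
square to the identity, then the commutators of involutions lie in a central subgroup of order at
most two. -/
lemma exists_uniform_central [Finite G] (hI : Nat.card G < 2 * (sqOne G).ncard)
    (hi : ∀ s ∈ sqOne G, (Subgroup.centralizer {s}).index ≤ 2) :
    ∃ z ∈ sqOne G, (∀ h, h * z = z * h) ∧
      ∀ s ∈ sqOne G, ∀ h, h * s * h⁻¹ = s ∨ h * s * h⁻¹ = s * z := by
  choose! z hz hzc hzs using fun s hs => exists_central_of_class_le_two hs (hi s hs)
  have hzs' : ∀ s ∈ sqOne G, ∀ h, h * s ≠ s * h → h * s * h⁻¹ = s * z s := fun s hs h hn =>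
    (hzs s hs h).resolve_left fun h' => hn (mul_inv_eq_iff_eq_mul.1 h')
  by_cases hall : ∃ s ∈ sqOne G, ∃ g, g * s ≠ s * g
  swap
  · push Not at hall
    exact ⟨1, mul_one 1, by simp, fun s hs h => Or.inl (by rw [hall s hs, mul_inv_cancel_right])⟩
  obtain ⟨s, hs, g, hg⟩ := hall
  -- Noncentral involutions with different `z` commute, since a nontrivial commutator of `s` and `t`
  -- would equal both `z s` and `z t`. Thus `s * t` is an involution with class of size at most two.
  -- If `h` moves `s` but not `t`, then `z (s * t) = z s`, which contradicts conjugation by a `k`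
  -- that moves `t`.
  have hcen : ∀ s ∈ sqOne G, ∀ t ∈ sqOne G, z s ≠ z t → (∃ g, g * s ≠ s * g) →
      (∃ g, g * t ≠ t * g) → ∀ h, h * t = t * h → h * s = s * h := by
    intro s hs t ht hst ⟨g, hg⟩ ⟨k, hk⟩ h hht
    have hs1 : z s ≠ 1 := fun h1 => hg (by
      rcases hzs s hs g with h | h
      · exact mul_inv_eq_iff_eq_mul.1 h
      · rw [h1, mul_one] at h
        exact mul_inv_eq_iff_eq_mul.1 h)
    have ht1 : z t ≠ 1 := fun h1 => hk (by
      rcases hzs t ht k with h | h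
      · exact mul_inv_eq_iff_eq_mul.1 h
      · rw [h1, mul_one] at h
        exact mul_inv_eq_iff_eq_mul.1 h)
    have hmul : z s * z t ≠ 1 := fun h1 => hst (by
      rw [← mul_inv_eq_one, inv_eq_of_mem_sqOne (hz t ht), h1])
    have hcomm : s * t = t * s := by
      by_contra hn
      have h1 := mul_inv_eq_iff_eq_mul.1 (hzs' s hs t (Ne.symm hn))
      have h2 := mul_inv_eq_iff_eq_mul.1 (hzs' t ht s hn)
      refine hmul ?_
      rw [mul_assoc s, ← hzc s hs t, ← mul_assoc s t, h2, mul_assoc t, ← hzc t ht s,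
        ← mul_assoc t s, mul_assoc (t * s), hzc s hs] at h1
      simpa using h1
    by_contra hhs
    have hw := hzs _ (mul_mem_sqOne hs ht hcomm)
    have hwh := hw h
    rw [conj_mul, hzs' s hs h hhs, mul_inv_eq_iff_eq_mul.2 hht, mul_assoc s, ← hzc s hs t,
      ← mul_assoc s] at hwh
    have hw1 : z (s * t) = z s := by
      rcases hwh with h1 | h1
      · exact absurd (by simpa using h1) hs1
      · simpa using h1.symm
    have hwk := hw k
    rw [conj_mul, hzs' t ht k hk, hw1] at hwk
    rcases hzs s hs k with h1 | h1 <;> rw [h1] at hwk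
    · rcases hwk with h2 | h2
      · exact ht1 (by simpa [← mul_assoc] using h2)
      · exact hst (by simpa [← mul_assoc] using h2.symm)
    · rw [mul_assoc s, ← mul_assoc (z s), ← hzc s hs t, mul_assoc t, ← mul_assoc s] at hwk
      rcases hwk with h2 | h2
      · exact hmul (by simpa using h2)
      · exact ht1 (by simpa using h2)
  refine ⟨z s, hz s hs, hzc s hs, fun t ht => ?_⟩
  by_contra! hcon
  obtain ⟨k, hk1, hk2⟩ := hcon
  have htk : k * t ≠ t * k := fun h => hk1 (mul_inv_eq_iff_eq_mul.2 h)
  have hst : z s ≠ z t := fun h => hk2 (by rw [h]; exact hzs' t ht k htk)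
  have h1 := hcen s hs t ht hst ⟨g, hg⟩ ⟨k, htk⟩
  have h2 := hcen t ht s hs hst.symm ⟨k, htk⟩ ⟨g, hg⟩
  -- Now `s` and `t` have the same centralizer. An involution `u` not commuting with `s` has `z u`
  -- different from `z s` or from `z t`; by `hcen` it then commutes with `s` or with `t`, hence with
  -- `s` in both cases.
  have h3 : Subgroup.centralizer {s} = ⊤ := by
    refine eq_top_of_sqOne_subset hI fun u hu => ?_
    refine Subgroup.mem_centralizer_singleton_iff.2 ?_
    by_contra hus
    have hus' : s * u ≠ u * s := fun h => hus h.symm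
    by_cases hzu : z u = z s
    · have h4 : ∀ h, h * u = u * h → h * t = t * h :=
        hcen t ht u hu (by rw [hzu]; exact hst.symm) ⟨k, htk⟩ ⟨s, hus'⟩
      exact hus (h1 u (h4 u rfl))
    · exact hus (hcen s hs u hu (Ne.symm hzu) ⟨g, hg⟩ ⟨s, hus'⟩ u rfl)
  have h4 : g ∈ Subgroup.centralizer {s} := by rw [h3]; trivial
  exact hg (Subgroup.mem_centralizer_singleton_iff.1 h4)

/-- The commutator subgroup and the squares lie in the central subgroup `{1, z}`. -/
structure IsClassTwo (z : G) : Prop where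
  sq : z ∈ sqOne G
  comm : ∀ h, h * z = z * h
  mul_comm : ∀ g h : G, g * h = h * g ∨ g * h = h * g * z
  mul_self : ∀ g : G, g * g = 1 ∨ g * g = z

/-- The elements whose commutators all lie in `{1, z}` form a subgroup containing every involution;
once this is all of `G`, the same holds for the elements whose square lies in `{1, z}`. -/
lemma exists_isClassTwo [Finite G] (hI : Nat.card G < 2 * (sqOne G).ncard)
    (hi : ∀ s ∈ sqOne G, (Subgroup.centralizer {s}).index ≤ 2) : ∃ z : G, IsClassTwo z := by
  obtain ⟨z, hz, hzc, hzs⟩ := exists_uniform_central hI hi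
  have hzz := mem_sqOne.1 hz
  have hc : ∀ g h : G, h * g = g * h ∨ h * g = g * h * z := by
    intro g
    let K : Subgroup G :=
      { carrier := {g | ∀ h, h * g = g * h ∨ h * g = g * h * z}
        one_mem' := fun h => by simp
        mul_mem' := fun {a b} ha hb h => by
          rcases ha h with h1 | h1 <;> rcases hb h with h2 | h2
          · left; rw [← mul_assoc, h1, mul_assoc, h2, mul_assoc]
          · right; rw [← mul_assoc, h1, mul_assoc, h2]; simp only [mul_assoc]
          · right; rw [← mul_assoc, h1, mul_assoc, ← hzc b, ← mul_assoc, mul_assoc a, h2]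
            simp only [mul_assoc]
          · left; rw [← mul_assoc, h1, mul_assoc, ← hzc b, ← mul_assoc, mul_assoc a, h2]
            simp only [mul_assoc, hzz, mul_one]
        inv_mem' := fun {a} ha h => by
          rcases ha h with h1 | h1
          · left
            rw [← mul_right_inj a, ← mul_left_inj a]
            simp [mul_assoc, h1]
          · right
            rw [← mul_right_inj a, ← mul_left_inj a]
            simp only [mul_assoc, inv_mul_cancel, mul_one, mul_inv_cancel_left, ← hzc a]
            rw [← mul_assoc h, h1, mul_assoc, mul_assoc, hzz, mul_one] }
    have hK : K = ⊤ := eq_top_of_sqOne_subset hI fun s hs h =>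
      (hzs s hs h).imp mul_inv_eq_iff_eq_mul.1 fun h' => by
        rw [mul_inv_eq_iff_eq_mul.1 h', mul_assoc, mul_assoc, hzc h]
    have : g ∈ K := by rw [hK]; trivial
    exact this
  refine ⟨z, hz, hzc, fun g h => hc h g, fun g => ?_⟩
  let K : Subgroup G :=
    { carrier := {g | g * g = 1 ∨ g * g = z}
      one_mem' := by simp
      mul_mem' := fun {a b} ha hb => by
        have h1 : a * b * (a * b) = a * a * (b * b) ∨ a * b * (a * b) = a * a * (b * b) * z := by
          rw [mul_assoc, ← mul_assoc b]
          rcases hc a b with h | h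
          · left; rw [h]; simp only [mul_assoc]
          · right; rw [h, mul_assoc (a * b) z b, ← hzc b]; simp only [mul_assoc]
        have ha' : a * a = 1 ∨ a * a = z := ha
        have hb' : b * b = 1 ∨ b * b = z := hb
        change a * b * (a * b) = 1 ∨ a * b * (a * b) = z
        rcases ha' with h | h <;> rcases hb' with h' | h' <;> rw [h, h'] at h1 <;>
          simpa [hzz, or_comm] using h1
      inv_mem' := fun {a} ha => by
        have ha' : a * a = 1 ∨ a * a = z := ha
        change a⁻¹ * a⁻¹ = 1 ∨ a⁻¹ * a⁻¹ = z
        rw [← mul_inv_rev]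
        rcases ha' with h | h <;> rw [h]
        · simp
        · exact Or.inr (inv_eq_of_mem_sqOne hz) }
  have hK : K = ⊤ := eq_top_of_sqOne_subset hI fun s hs => Or.inl hs
  have : g ∈ K := by rw [hK]; trivial
  exact this

variable {z : G}

/-- A subgroup in which more than half of the elements square to the identity is elementary abelian
or splits off a dihedral group of order eight. -/
lemma IsClassTwo.exists_splitting [Finite G] (hz : IsClassTwo z) {H : Subgroup G} (hzH : z ∈ H)
    (hI : Nat.card H < 2 * ((H : Set G) ∩ sqOne G).ncard) :
    (∀ x ∈ H, x ∈ sqOne G) ∨ ∃ s ∈ H, ∃ t ∈ H, ∃ K ≤ H, s ∈ sqOne G ∧ t ∈ sqOne G ∧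
      s * t = t * s * z ∧ s * t ≠ t * s ∧ z ∈ K ∧ (∀ x ∈ K, x * s = s * x) ∧
      (∀ x ∈ K, x * t = t * x) ∧
      Nat.card H = 4 * Nat.card K ∧
      ((H : Set G) ∩ sqOne G).ncard ≤ 2 * ((K : Set G) ∩ sqOne G).ncard + Nat.card K ∧
      ∀ R : Subgroup G, s ∈ R → t ∈ R → K ≤ R → H ≤ R := by
  by_cases hab : ∀ s ∈ H, ∀ t ∈ H, s ∈ sqOne G → t ∈ sqOne G → s * t = t * s
  · exact Or.inl (subset_sqOne_of_commute hI hab)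
  push Not at hab
  obtain ⟨s, hsH, t, htH, hs, ht, hst⟩ := hab
  have hstz := (hz.mul_comm s t).resolve_left hst
  have hss := mem_sqOne.1 hs
  have htt := mem_sqOne.1 ht
  have hzz := mem_sqOne.1 hz.sq
  have htsz : t * s = s * t * z := by rw [hstz, mul_assoc, hzz, mul_one]
  set M := H ⊓ Subgroup.centralizer {s} with hM
  set K := M ⊓ Subgroup.centralizer {t} with hK
  have hKs : ∀ x ∈ K, x * s = s * x := fun x hx => Subgroup.mem_centralizer_singleton_iff.1 hx.1.2
  have hKt : ∀ x ∈ K, x * t = t * x := fun x hx => Subgroup.mem_centralizer_singleton_iff.1 hx.2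
  -- If `x` and `v` both fail to commute with `u`, the two factors `z` cancel in `v * x`. Hence each
  -- further centralizer has index two.
  have step : ∀ u v : G, v * u = u * v * z → ∀ x, x * u = u * x ∨ (v * x) * u = u * (v * x) := by
    intro u v huv x
    rcases hz.mul_comm x u with h | h
    · exact Or.inl h
    · right
      rw [mul_assoc, h, ← mul_assoc, ← mul_assoc, huv, mul_assoc (u * v), ← hz.comm x,
        ← mul_assoc (u * v), mul_assoc _ z z, hzz, mul_one, mul_assoc]
  have hcov1 : ∀ x ∈ H, x ∈ M ∨ t * x ∈ M := fun x hx =>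
    (step s t htsz x).imp (fun h => ⟨hx, Subgroup.mem_centralizer_singleton_iff.2 h⟩)
      fun h => ⟨H.mul_mem htH hx, Subgroup.mem_centralizer_singleton_iff.2 h⟩
  have hsM : s ∈ M := ⟨hsH, mem_centralizer_self s⟩
  have hcov2 : ∀ x ∈ M, x ∈ K ∨ s * x ∈ K := fun x hx =>
    (step t s hstz x).imp (fun h => ⟨hx, Subgroup.mem_centralizer_singleton_iff.2 h⟩)
      fun h => ⟨M.mul_mem hsM hx, Subgroup.mem_centralizer_singleton_iff.2 h⟩
  have hc1 : Nat.card H = 2 * Nat.card M := card_eq_two_mul inf_le_left htH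
    (fun h => hst (Subgroup.mem_centralizer_singleton_iff.1 h.2).symm) hcov1
  have hc2 : Nat.card M = 2 * Nat.card K := card_eq_two_mul inf_le_left hsM
    (fun h => hst (Subgroup.mem_centralizer_singleton_iff.1 h.2)) hcov2
  have hcov : ∀ x ∈ H, ∃ y ∈ K, x = y ∨ x = s * y ∨ x = t * y ∨ x = t * (s * y) := by
    intro x hx
    have hu : ∀ u v : G, u * u = 1 → v = u * (u * v) := fun u v hu => by
      rw [← mul_assoc, hu, one_mul]
    rcases hcov1 x hx with h1 | h1 <;> rcases hcov2 _ h1 with h2 | h2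
    · exact ⟨_, h2, Or.inl rfl⟩
    · exact ⟨_, h2, Or.inr (Or.inl (hu s x hss))⟩
    · exact ⟨_, h2, Or.inr (Or.inr (Or.inl (hu t x htt)))⟩
    · refine ⟨_, h2, Or.inr (Or.inr (Or.inr ?_))⟩
      rw [← hu s _ hss, ← hu t x htt]
  refine Or.inr ⟨s, hsH, t, htH, K, inf_le_left.trans inf_le_left, hs, ht, hstz, hst, ?_, hKs, hKt,
    by omega, ?_, ?_⟩
  · exact ⟨⟨hzH, Subgroup.mem_centralizer_singleton_iff.2 (hz.comm s).symm⟩,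
      Subgroup.mem_centralizer_singleton_iff.2 (hz.comm t).symm⟩
  · set A := (K : Set G) ∩ sqOne G
    set B := (K : Set G) \ sqOne G
    have hAB : A.ncard + B.ncard = Nat.card K :=
      Set.ncard_inter_add_ncard_sdiff_eq_ncard _ _ (Set.toFinite _)
    have hsub : (H : Set G) ∩ sqOne G ⊆
        (A ∪ (s * ·) '' A) ∪ ((t * ·) '' A ∪ (fun y => t * (s * y)) '' B) := by
      rintro x ⟨hx, hxs⟩
      have hu : ∀ u y : G, u * u = 1 → y * u = u * y → u * y ∈ sqOne G → y ∈ sqOne G := by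
        intro u y hu huy h
        rw [mem_sqOne] at *
        rwa [mul_assoc, ← mul_assoc y u, huy, mul_assoc u y y, ← mul_assoc, hu, one_mul] at h
      obtain ⟨y, hy, rfl | rfl | rfl | rfl⟩ := hcov x hx
      · exact Or.inl (Or.inl ⟨hy, hxs⟩)
      · exact Or.inl (Or.inr ⟨y, ⟨hy, hu s y hss (hKs y hy) hxs⟩, rfl⟩)
      · exact Or.inr (Or.inl ⟨y, ⟨hy, hu t y htt (hKt y hy) hxs⟩, rfl⟩)
      · refine Or.inr (Or.inr ⟨y, ⟨hy, fun hys => hst ?_⟩, rfl⟩)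
        rw [mem_sqOne] at hys hxs
        -- In the coset of `t * s` the square is `(t * s)² * y²`, so `y² = 1` is impossible there.
        -- The other three cosets contribute only through `y` of square one.
        have h1 : t * (s * y) * (t * (s * y)) = t * s * (t * s) * (y * y) := by
          simp only [mul_assoc]
          rw [← mul_assoc y t, hKt y hy, mul_assoc t y, ← mul_assoc y s, hKs y hy, mul_assoc s y]
        rw [h1, hys, mul_one] at hxs
        exact commute_of_mul_mem_sqOne ht hs hxs |>.symm
    have h1 := Set.ncard_le_ncard hsub (Set.toFinite _)
    have h2 := Set.ncard_union_le (A ∪ (s * ·) '' A) ((t * ·) '' A ∪ (fun y => t * (s * y)) '' B)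
    have h3 := Set.ncard_union_le A ((s * ·) '' A)
    have h4 := Set.ncard_union_le ((t * ·) '' A) ((fun y => t * (s * y)) '' B)
    have h5 := Set.ncard_image_le (f := (s * ·)) (Set.toFinite A)
    have h6 := Set.ncard_image_le (f := (t * ·)) (Set.toFinite A)
    have h7 := Set.ncard_image_le (f := fun y => t * (s * y)) (Set.toFinite B)
    omega
  · intro R hsR htR hKR x hx
    obtain ⟨y, hy, rfl | rfl | rfl | rfl⟩ := hcov x hx
    · exact hKR hy
    · exact R.mul_mem hsR (hKR hy)
    · exact R.mul_mem htR (hKR hy)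
    · exact R.mul_mem htR (R.mul_mem hsR (hKR hy))

lemma natCard_zpowers_of_mem_sqOne (hz : z ∈ sqOne G) (h1 : z ≠ 1) :
    Nat.card (Subgroup.zpowers z) = 2 := by
  rw [Nat.card_zpowers]
  exact orderOf_eq_prime (pow_two_of_mem_sqOne hz) h1

lemma IsClassTwo.mul_pow_two {s t : G} (hz : IsClassTwo z) (hs : s ∈ sqOne G) (ht : t ∈ sqOne G)
    (hst : s * t = t * s * z) : (s * t) ^ 2 = z := by
  rw [pow_two]
  nth_rw 1 [hst]
  rw [hz.comm, mul_assoc, mul_assoc t, ← mul_assoc s s, mem_sqOne.1 hs, one_mul, mem_sqOne.1 ht,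
    mul_one]

/-- Two involutions with commutator `z` generate an image of the dihedral group of order eight. -/
lemma IsClassTwo.exists_dihedralHom {s t : G} (hz : IsClassTwo z) (hs : s ∈ sqOne G)
    (ht : t ∈ sqOne G) (hst : s * t = t * s * z) :
    ∃ f : DihedralGroup 4 →* G, s ∈ f.range ∧ t ∈ f.range ∧ f (.r 2) = z ∧
      ∀ H : Subgroup G, s ∈ H → t ∈ H → ∀ x, f x ∈ H := by
  have h2 := hz.mul_pow_two hs ht hst
  have h4 : (s * t) ^ 4 = 1 := by
    rw [show 4 = 2 * 2 from rfl, pow_mul, h2, pow_two_of_mem_sqOne hz.sq]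
  have hinv : s * (s * t) * s⁻¹ = (s * t)⁻¹ := by
    rw [mul_inv_rev, inv_eq_of_mem_sqOne ht, ← mul_assoc, mem_sqOne.1 hs, one_mul]
  refine ⟨dihedralHom (s * t) s h4 hs hinv, ⟨_, dihedralHom_sr_zero h4 hs hinv⟩,
    ⟨.sr 0 * .r 1, ?_⟩, ?_, fun H hsH htH => dihedralHom_mem h4 hs hinv (H.mul_mem hsH htH) hsH⟩
  · rw [map_mul, dihedralHom_sr_zero, dihedralHom_r_one, ← mul_assoc, mem_sqOne.1 hs, one_mul]
  · exact (dihedralHom_r h4 hs hinv 2).trans h2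

/-- By the counting clause of `exists_splitting`, densities above 9/16 in `G` become above 5/8 in
`K` and above 3/4 in `L`. A third splitting would need density above 1. -/
theorem IsClassTwo.classification [Finite G] (hz : IsClassTwo z)
    (hI : 9 * Nat.card G < 16 * (sqOne G).ncard) :
    (∀ x, x ∈ sqOne G) ∨ (∃ k : ℕ, Nonempty (G ≃* DihedralGroup 4 × CycTwoPow k)) ∨
      ∃ k : ℕ, Nonempty (G ≃* D8CentralD8 × CycTwoPow k) := by
  have hfin : Finite D8CentralD8 := inferInstance
  have ht0 : Nat.card (⊤ : Subgroup G) = Nat.card G := Subgroup.card_top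
  have ht1 : ((⊤ : Subgroup G) : Set G) ∩ sqOne G = sqOne G := by simp
  rcases hz.exists_splitting (H := ⊤) trivial (by rw [ht0, ht1]; omega) with
    h | ⟨s, -, t, -, K, -, hs, ht, hst, hne, hzK, hKs, hKt, hcK, hIK, hgen⟩
  · exact Or.inl fun x => h x trivial
  right
  rw [ht0] at hcK
  rw [ht1] at hIK
  have hz1 : z ≠ 1 := fun h => hne (by rw [hst, h, mul_one])
  obtain ⟨f, hfs, hft, hfz, hfH⟩ := hz.exists_dihedralHom hs ht hst
  have hW := natCard_zpowers_of_mem_sqOne hz.sq hz1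
  have hfK : ∀ p, ∀ x ∈ K, f p * x = x * f p := fun p x hx =>
    Subgroup.mem_centralizer_singleton_iff.1 <| hfH (Subgroup.centralizer {x})
      (Subgroup.mem_centralizer_singleton_iff.2 (hKs x hx).symm)
      (Subgroup.mem_centralizer_singleton_iff.2 (hKt x hx).symm) p
  rcases hz.exists_splitting hzK (by omega) with
    h | ⟨s', hs'K, t', ht'K, L, hLK, hs', ht', hst', -, hzL, hLs', hLt', hcL, hIL, hgen'⟩
  · left
    refine exists_mulEquiv_prod (Z := K) (W := Subgroup.zpowers z) f ?_ ?_ h hfK ?_ ?_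
    · simpa using hzK
    · simpa using ⟨_, hfz⟩
    · exact top_le_iff.1 (hgen _ (Subgroup.mem_sup_left hfs) (Subgroup.mem_sup_left hft)
        le_sup_right)
    · rw [DihedralGroup.nat_card, hW]
      omega
  · right
    obtain ⟨g, hgs, hgt, hgz, hgH⟩ := hz.exists_dihedralHom hs' ht' hst'
    have hLsq : ∀ x ∈ L, x ∈ sqOne G := by
      rcases hz.exists_splitting hzL (by omega) with
        h | ⟨_, _, _, _, M, _, _, _, _, _, _, _, _, hcM, hIM, _⟩
      · exact h
      · have := ncard_inter_sqOne_le_card M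
        omega
    have hcomm : ∀ x y, Commute (f x) (g y) := fun x y => hfK x _ (hgH K hs'K ht'K y)
    let F := d8CentralD8Hom f g hcomm (hfz.trans hgz.symm)
    have hF1 : f.range ≤ F.range := by
      rintro _ ⟨x, rfl⟩
      exact ⟨QuotientGroup.mk (x, 1), by rw [d8CentralD8Hom_mk, map_one, mul_one]⟩
    have hF2 : g.range ≤ F.range := by
      rintro _ ⟨x, rfl⟩
      exact ⟨QuotientGroup.mk (1, x), by rw [d8CentralD8Hom_mk, map_one, one_mul]⟩
    refine exists_mulEquiv_prod (Z := L) (W := Subgroup.zpowers z) F ?_ ?_ hLsq ?_ ?_ ?_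
    · simpa using hzL
    · simpa using hF1 ⟨_, hfz⟩
    · intro p x hx
      obtain ⟨⟨p, q⟩, rfl⟩ := QuotientGroup.mk_surjective p
      rw [d8CentralD8Hom_mk]
      have h1 : g q * x = x * g q :=
        Subgroup.mem_centralizer_singleton_iff.1 <| hgH (Subgroup.centralizer {x})
          (Subgroup.mem_centralizer_singleton_iff.2 (hLs' x hx).symm)
          (Subgroup.mem_centralizer_singleton_iff.2 (hLt' x hx).symm) q
      rw [mul_assoc, h1, ← mul_assoc, hfK p x (hLK hx), mul_assoc]
    · have hle : K ≤ F.range ⊔ L := hgen' _ (Subgroup.mem_sup_left (hF2 hgs))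
        (Subgroup.mem_sup_left (hF2 hgt)) le_sup_right
      exact top_le_iff.1 (hgen _ (Subgroup.mem_sup_left (hF1 hfs))
        (Subgroup.mem_sup_left (hF1 hft)) hle)
    · rw [hW]
      have := Nat.mul_le_mul_right (Nat.card L) natCard_D8CentralD8_le
      omega

end classTwo

/-! ### An involution whose centralizer has index four -/

section indexFour

variable {G : Type*} [Group G]

/-- An involution `t` whose class has four elements, in a group in which more than `9/16` of the
elements square to the identity. -/
structure IsIndexFour (t : G) : Prop where
  mem : t ∈ sqOne G
  card : Nat.card G = 4 * Nat.card (Subgroup.centralizer {t})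
  many : 9 * Nat.card G < 16 * (sqOne G).ncard

namespace IsIndexFour

variable {t : G}

lemma mul_self (h : IsIndexFour t) : t * t = 1 := h.mem

variable [Finite G] (h : IsIndexFour t)

include h

lemma two_mul_ncard_le :
    2 * (sqOne G).ncard ≤ 5 * Nat.card (Subgroup.centralizer {t}) := by
  have h1 := two_mul_ncard_sqOne_add_card_centralizer_le h.mem
  have h2 := ncard_inter_sqOne_le_card (Subgroup.centralizer {t})
  have h3 := h.card
  omega

lemma mem_sqOne_of_mem : ∀ x ∈ Subgroup.centralizer {t}, x ∈ sqOne G := by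
  refine subset_sqOne_of_three_mul_card_lt ?_
  have h1 := two_mul_ncard_sqOne_add_card_centralizer_le h.mem
  have h3 := h.card
  have h4 := h.many
  omega

/-- The total exceeds `9/4 |C|`. At most `|C|` comes from `C`, and at most `|C|` from the two cosets
other than `C` and `C g`, whose union is stable under left multiplication by `t`. -/
lemma card_lt_ncard_coset {g : G} (hg : g ∉ Subgroup.centralizer {t}) :
    Nat.card (Subgroup.centralizer {t}) <
      4 * (((· * g) '' (Subgroup.centralizer {t} : Set G)) ∩ sqOne G).ncard := by
  set C := Subgroup.centralizer {t} with hC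
  set D := (· * g) '' (C : Set G) with hD
  set R := ((C : Set G) ∪ D)ᶜ with hR
  have hdisj : Disjoint (C : Set G) D := by
    rw [Set.disjoint_left]
    rintro _ hx ⟨c, hc, rfl⟩
    exact hg ((C.mul_mem_cancel_left hc).1 hx)
  have hDc : D.ncard = Nat.card C := Set.ncard_image_of_injective _ (mul_left_injective g)
  have hu := Set.ncard_union_eq hdisj (Set.toFinite _) (Set.toFinite _)
  have hRc : _ + R.ncard = Nat.card G := Set.ncard_add_ncard_compl ((C : Set G) ∪ D)
  have hCc : (C : Set G).ncard = Nat.card C := rfl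
  have hR2 : 2 * (R ∩ sqOne G).ncard ≤ R.ncard := by
    refine two_mul_ncard_sqOne_inter_le h.mem R ?_ ?_
    · exact fun u hu h' => hu (Or.inl (Subgroup.mem_centralizer_singleton_iff.2 h'))
    · rintro u hu (h' | ⟨c, hc, h'⟩)
      · exact hu (Or.inl ((C.mul_mem_cancel_left (mem_centralizer_self t)).1 h'))
      · refine hu (Or.inr ⟨t * c, C.mul_mem (mem_centralizer_self t) hc, ?_⟩)
        change c * g = t * u at h'
        change t * c * g = u
        rw [mul_assoc, h', ← mul_assoc, h.mul_self, one_mul]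
  have hS : sqOne G ⊆ (C ∩ sqOne G : Set G) ∪ (D ∩ sqOne G) ∪ (R ∩ sqOne G) := by
    intro x hx
    by_cases h1 : x ∈ (C : Set G) ∪ D
    · exact Or.inl (h1.imp (fun h => ⟨h, hx⟩) fun h => ⟨h, hx⟩)
    · exact Or.inr ⟨h1, hx⟩
  have h1 := Set.ncard_le_ncard hS (Set.toFinite _)
  have h2 := Set.ncard_union_le ((C ∩ sqOne G : Set G) ∪ (D ∩ sqOne G)) (R ∩ sqOne G)
  have h3 := Set.ncard_union_le (C ∩ sqOne G : Set G) (D ∩ sqOne G)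
  have h4 := ncard_inter_sqOne_le_card C
  have h5 : Nat.card G = 4 * Nat.card C := h.card
  have h6 := h.many
  omega

lemma exists_mul_mem_sqOne {g : G} (hg : g ∉ Subgroup.centralizer {t}) :
    ∃ c ∈ Subgroup.centralizer {t}, c * g ∈ sqOne G := by
  have h1 := h.card_lt_ncard_coset hg
  have h2 : (((· * g) '' (Subgroup.centralizer {t} : Set G)) ∩ sqOne G).ncard ≠ 0 := by omega
  obtain ⟨_, ⟨c, hc, rfl⟩, hx⟩ := Set.nonempty_of_ncard_ne_zero h2
  exact ⟨c, hc, hx⟩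

/-- For `c ∈ C`, the product `c * x` has square one only if `c` commutes with `x`. So the
centralizer of `x` in `C` has index less than 4; it omits `t`, and `C` is a 2-group, so the index is
2. -/
lemma card_eq {x : G} (hx : x ∈ sqOne G) (hxC : x ∉ Subgroup.centralizer {t}) :
    Nat.card (Subgroup.centralizer {t}) =
      2 * Nat.card (Subgroup.centralizer {t} ⊓ Subgroup.centralizer {x} : Subgroup G) := by
  have h1 := h.card_lt_ncard_coset hxC
  set C := Subgroup.centralizer {t} with hC
  set M := C ⊓ Subgroup.centralizer {x} with hM
  have hsub : ((· * x) '' (C : Set G)) ∩ sqOne G ⊆ (· * x) '' (M : Set G) := by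
    rintro _ ⟨⟨c, hc, rfl⟩, hcx⟩
    exact ⟨c, ⟨hc, Subgroup.mem_centralizer_singleton_iff.2
      (commute_of_mul_mem_sqOne (h.mem_sqOne_of_mem c hc) hx hcx)⟩, rfl⟩
  have h2 := Set.ncard_le_ncard hsub (Set.toFinite _)
  rw [Set.ncard_image_of_injective _ (mul_left_injective x)] at h2
  change _ ≤ Nat.card M at h2
  have hne : Nat.card M ≠ Nat.card C := fun he => by
    have := Subgroup.eq_of_le_of_card_ge (inf_le_left : M ≤ C) he.ge
    have ht : t ∈ M := this.ge (mem_centralizer_self t)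
    exact hxC (Subgroup.mem_centralizer_singleton_iff.2
      (Subgroup.mem_centralizer_singleton_iff.1 ht.2).symm)
  obtain ⟨m, hm⟩ := Subgroup.card_dvd_of_le (inf_le_left : M ≤ C)
  have hM0 : 0 < Nat.card M := Nat.card_pos
  have hC0 : 0 < Nat.card C := Nat.card_pos
  have hm4 : m < 4 := by
    by_contra! h4
    nlinarith
  have hp : m ≠ 3 := by
    rintro rfl
    have hp2 : IsPGroup 2 C := fun y => ⟨1, by
      rw [pow_one]
      exact Subtype.ext (pow_two_of_mem_sqOne (h.mem_sqOne_of_mem _ y.2))⟩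
    obtain ⟨k, hk⟩ := IsPGroup.iff_card.1 hp2
    have : 3 ∣ 2 ^ k := hk ▸ hm ▸ Dvd.intro_left _ rfl
    exact absurd ((Nat.prime_dvd_prime_iff_eq Nat.prime_three Nat.prime_two).1
      (Nat.prime_three.dvd_of_dvd_pow this)) (by norm_num)
  change Nat.card C = 2 * Nat.card M
  change Nat.card C = Nat.card M * m at hm
  interval_cases m <;> omega

lemma commute_or_mul_commute {x : G} (hx : x ∈ sqOne G) (hxC : x ∉ Subgroup.centralizer {t})
    {c : G} (hc : c ∈ Subgroup.centralizer {t}) : c * x = x * c ∨ c * t * x = x * (c * t) := by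
  have h1 := h.card_eq hx hxC
  set C := Subgroup.centralizer {t} with hC
  set M := C ⊓ Subgroup.centralizer {x} with hM
  have htC : t ∈ C := mem_centralizer_self t
  have htM : t ∉ M := fun ht => hxC (Subgroup.mem_centralizer_singleton_iff.2
      (Subgroup.mem_centralizer_singleton_iff.1 ht.2).symm)
  have hdisj : Disjoint (M : Set G) ((· * t) '' (M : Set G)) := by
    rw [Set.disjoint_left]
    rintro _ hy ⟨d, hd, rfl⟩
    exact htM ((M.mul_mem_cancel_left hd).1 hy)
  have h2 := Set.ncard_union_eq hdisj (Set.toFinite _) (Set.toFinite _)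
  rw [Set.ncard_image_of_injective _ (mul_left_injective t)] at h2
  have h3 : (M : Set G) ∪ (· * t) '' (M : Set G) = C := by
    refine Set.eq_of_subset_of_ncard_le ?_ ?_ (Set.toFinite _)
    · rintro _ (hy | ⟨d, hd, rfl⟩)
      · exact hy.1
      · exact C.mul_mem hd.1 htC
    · rw [h2]
      change Nat.card C ≤ Nat.card M + Nat.card M
      omega
  have h4 : c ∈ (M : Set G) ∪ (· * t) '' (M : Set G) := by rw [h3]; exact hc
  rcases h4 with h4 | ⟨d, hd, rfl⟩
  · exact Or.inl (Subgroup.mem_centralizer_singleton_iff.1 h4.2)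
  · right
    change d * t * t * x = x * (d * t * t)
    rw [mul_assoc d, h.mul_self, mul_one]
    exact Subgroup.mem_centralizer_singleton_iff.1 hd.2

/-- If some conjugate of `t` by an involution does not commute with `t`, there are many elements
of order at least eight. -/
lemma exists_many_pow_four_ne {x : G} (hx : x ∈ sqOne G) (hxC : x ∉ Subgroup.centralizer {t})
    (hxt : x * t * x ∉ Subgroup.centralizer {t}) :
    Nat.card (Subgroup.centralizer {t}) ≤ 2 * {y : G | y ^ 4 ≠ 1}.ncard := by
  have h1 := h.card_eq hx hxC
  set M := Subgroup.centralizer {t} ⊓ Subgroup.centralizer {x} with hM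
  have hxx := mem_sqOne.1 hx
  -- For `c` commuting with `t` and `x`, `(t * x * c)⁴ = (t * x)⁴ = (t * (x * t * x))²`, which is 1
  -- only if `t` commutes with `x * t * x`. These `c` make up half of the centralizer of `t`.
  have hsub : (t * x * ·) '' (M : Set G) ⊆ {y : G | y ^ 4 ≠ 1} := by
    rintro _ ⟨c, hc, rfl⟩ h4
    have hct := Subgroup.mem_centralizer_singleton_iff.1 hc.1
    have hcx := Subgroup.mem_centralizer_singleton_iff.1 hc.2
    have hcomm : Commute (t * x) c :=
      Commute.mul_left (Commute.symm hct) (Commute.symm hcx)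
    have hcc : c ^ 4 = 1 := by
      rw [show 4 = 2 * 2 from rfl, pow_mul, pow_two_of_mem_sqOne (h.mem_sqOne_of_mem c hc.1),
        one_pow]
    change (t * x * c) ^ 4 = 1 at h4
    rw [hcomm.mul_pow, hcc, mul_one] at h4
    have hu : x * t * x ∈ sqOne G := by
      rw [mem_sqOne]
      calc x * t * x * (x * t * x) = x * t * (x * x) * t * x := by group
        _ = x * (t * t) * x := by rw [hxx]; group
        _ = 1 := by rw [h.mul_self, mul_one, hxx]
    have h5 : t * (x * t * x) ∈ sqOne G := by
      rw [mem_sqOne, ← h4]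
      simp only [pow_succ, pow_zero, one_mul, mul_assoc]
    exact hxt (Subgroup.mem_centralizer_singleton_iff.2
      (commute_of_mul_mem_sqOne h.mem hu h5).symm)
  have h2 := Set.ncard_le_ncard hsub (Set.toFinite _)
  rw [Set.ncard_image_of_injective _ (mul_right_injective (t * x))] at h2
  change Nat.card M ≤ _ at h2
  omega

lemma conj_eq_or {x : G} (hx : x ∈ sqOne G) (hxC : x ∉ Subgroup.centralizer {t})
    {c : G} (hc : c ∈ Subgroup.centralizer {t}) :
    x * c * x = c ∨ x * c * x = c * (t * (x * t * x)) := by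
  have hxx := mem_sqOne.1 hx
  rcases h.commute_or_mul_commute hx hxC hc with h1 | h1
  · left
    rw [← h1, mul_assoc, hxx, mul_one]
  · right
    have h2 : x * c * x = x * (c * t) * (t * x) := by
      rw [mul_assoc, mul_assoc, mul_assoc c, ← mul_assoc t, h.mul_self, one_mul]
    rw [h2, ← h1]
    simp only [mul_assoc]

lemma mul_comm_of_mem {c d : G} (hc : c ∈ Subgroup.centralizer {t})
    (hd : d ∈ Subgroup.centralizer {t}) : c * d = d * c :=
  commute_of_mul_mem_sqOne (h.mem_sqOne_of_mem c hc) (h.mem_sqOne_of_mem d hd)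
    (h.mem_sqOne_of_mem _ (Subgroup.mul_mem _ hc hd))

end IsIndexFour

/-- An element as in `IsIndexFour` all of whose conjugates by involutions commute with it. -/
structure IsNormalIndexFour (t : G) : Prop extends IsIndexFour t where
  conj_mem : ∀ x ∈ sqOne G, x ∉ Subgroup.centralizer {t} → x * t * x ∈ Subgroup.centralizer {t}

/-! ### The action of the nontrivial cosets on the centralizer of `t` -/

namespace IsNormalIndexFour

variable {t : G} [Finite G] (h : IsNormalIndexFour t)

/-- The commutator of `t` with an involution `x`. -/
def zeta (t x : G) : G := t * (x * t * x)

omit [Finite G] in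
lemma conj_eq (h : IsNormalIndexFour t) (x : G) : x * t * x = t * zeta t x := by
  rw [zeta, ← mul_assoc, h.mul_self, one_mul]

include h

section one

variable {x : G} (hx : x ∈ sqOne G) (hxC : x ∉ Subgroup.centralizer {t})

include hx hxC

omit [Finite G] in
lemma zeta_mem : zeta t x ∈ Subgroup.centralizer {t} :=
  Subgroup.mul_mem _ (mem_centralizer_self t) (h.conj_mem x hx hxC)

lemma zeta_mem_sqOne : zeta t x ∈ sqOne G := h.mem_sqOne_of_mem _ (h.zeta_mem hx hxC)

omit [Finite G] in
lemma zeta_ne_one : zeta t x ≠ 1 := fun h1 => hxC <| by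
  have h2 := h.conj_eq x
  rw [h1, mul_one] at h2
  rw [Subgroup.mem_centralizer_singleton_iff]
  conv_rhs => rw [← h2]
  rw [mul_assoc, mem_sqOne.1 hx, mul_one]

lemma conj_eq_or' {c : G} (hc : c ∈ Subgroup.centralizer {t}) :
    x * c * x = c ∨ x * c * x = c * zeta t x := h.conj_eq_or hx hxC hc

lemma conj_mem_centralizer {c : G} (hc : c ∈ Subgroup.centralizer {t}) :
    x * c * x ∈ Subgroup.centralizer {t} := by
  rcases h.conj_eq_or' hx hxC hc with h1 | h1 <;> rw [h1]
  · exact hc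
  · exact Subgroup.mul_mem _ hc (h.zeta_mem hx hxC)

lemma conj_zeta_self : x * zeta t x * x = zeta t x := by
  have hxx := mem_sqOne.1 hx
  have h1 : x * zeta t x * x = (zeta t x)⁻¹ := by
    rw [eq_inv_iff_mul_eq_one, zeta]
    calc x * (t * (x * t * x)) * x * (t * (x * t * x))
        = x * t * x * t * (x * x) * t * x * t * x := by group
      _ = x * t * x * (t * t) * x * t * x := by rw [hxx]; group
      _ = x * t * (x * x) * t * x := by rw [h.mul_self]; group
      _ = x * (t * t) * x := by rw [hxx]; group
      _ = 1 := by rw [h.mul_self, mul_one, hxx]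
  rw [h1, inv_eq_of_mem_sqOne (h.zeta_mem_sqOne hx hxC)]

end one

section two

variable {x y : G} (hx : x ∈ sqOne G) (hxC : x ∉ Subgroup.centralizer {t})
  (hy : y ∈ sqOne G) (hyC : y ∉ Subgroup.centralizer {t}) (hxy : x * y ∉ Subgroup.centralizer {t})

omit [Finite G] h in
include hx hy hxy in
lemma mul_notMem_comm : y * x ∉ Subgroup.centralizer {t} := fun h1 => hxy <| by
  rw [← inv_mem_iff, mul_inv_rev, inv_eq_of_mem_sqOne hx, inv_eq_of_mem_sqOne hy]
  exact h1

omit [Finite G] in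
include hx hy hxy in
lemma zeta_ne_zeta : zeta t x ≠ zeta t y := fun h1 => by
  have h2 : x * t * x = y * t * y := by rw [h.conj_eq, h.conj_eq, h1]
  refine mul_notMem_comm hx hy hxy (Subgroup.mem_centralizer_singleton_iff.2 ?_)
  have h3 : y * (x * t * x) * x = y * (y * t * y) * x := by rw [h2]
  simpa only [mul_assoc, mem_sqOne.1 hx, mul_mul_cancel_of_mem_sqOne hy, mul_one] using h3

include hx hxC hy hyC hxy

/-- An involution in the coset of `x * y` acts on the centralizer of `t` as `x * y` does. -/
lemma exists_third : ∃ d ∈ Subgroup.centralizer {t}, ∃ w ∈ sqOne G,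
    w ∉ Subgroup.centralizer {t} ∧ w = d * (x * y) ∧
    ∀ c ∈ Subgroup.centralizer {t}, w * c * w = x * (y * c * y) * x := by
  obtain ⟨d, hd, hw⟩ := h.exists_mul_mem_sqOne hxy
  refine ⟨d, hd, _, hw, fun h1 => hxy ((Subgroup.mul_mem_cancel_left _ hd).1 h1), rfl,
    fun c hc => ?_⟩
  have h1 : d * (x * y) * c * (d * (x * y)) = d * (x * (y * c * y) * x) * d := by
    nth_rw 2 [← inv_eq_of_mem_sqOne hw]
    rw [mul_inv_rev, mul_inv_rev, inv_eq_of_mem_sqOne hx, inv_eq_of_mem_sqOne hy,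
      inv_eq_of_mem_sqOne (h.mem_sqOne_of_mem d hd)]
    simp only [mul_assoc]
  have h2 := h.conj_mem_centralizer hx hxC (h.conj_mem_centralizer hy hyC hc)
  rw [h1, h.mul_comm_of_mem hd h2, mul_assoc, mem_sqOne.1 (h.mem_sqOne_of_mem d hd), mul_one]

/-- Otherwise `x` sends `zeta t y` to `zeta t y * zeta t x`, and the involution `w` in the coset of
`x * y` conjugates `t` exactly as `y` does, although `w * y ∉ C`. -/
lemma conj_zeta : x * zeta t y * x = zeta t y := by
  have hz := h.zeta_mem hy hyC
  refine (h.conj_eq_or' hx hxC hz).resolve_right fun h1 => ?_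
  obtain ⟨d, hd, w, hw, hwC, hwd, hact⟩ := h.exists_third hx hxC hy hyC hxy
  have h2 : w * t * w = y * t * y := by
    rw [hact t (mem_centralizer_self t), h.conj_eq y]
    have h3 : x * (t * zeta t y) * x = x * t * x * (x * zeta t y * x) := by
      simp only [mul_assoc, mul_mul_cancel_of_mem_sqOne hx]
    rw [h3, h1, h.conj_eq x, h.mul_comm_of_mem hz (h.zeta_mem hx hxC), mul_assoc,
      mul_mul_cancel_of_mem_sqOne (h.zeta_mem_sqOne hx hxC)]
  have h4 : w * y ∉ Subgroup.centralizer {t} := by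
    rw [hwd, mul_assoc, mul_assoc, mem_sqOne.1 hy, mul_one, Subgroup.mul_mem_cancel_left _ hd]
    exact hxC
  refine h.zeta_ne_zeta hw hy h4 ?_
  rw [zeta, zeta, h2]

lemma zeta_third {w : G} (hw : ∀ c ∈ Subgroup.centralizer {t}, w * c * w = x * (y * c * y) * x) :
    zeta t w = zeta t x * zeta t y := by
  have h3 : x * (t * zeta t y) * x = x * t * x * (x * zeta t y * x) := by
    simp only [mul_assoc, mul_mul_cancel_of_mem_sqOne hx]
  rw [zeta, hw t (mem_centralizer_self t), h.conj_eq y, h3, h.conj_zeta hx hxC hy hyC hxy,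
    h.conj_eq x, mul_assoc, ← mul_assoc t t, h.mul_self, one_mul]

/-- If `x` fixed `c` and `y` did not, `w` would multiply `c` by `zeta t y`, but it can only multiply
it by 1 or by `zeta t w = zeta t x * zeta t y`. Hence what `x` centralizes in `C` is central in `G`.
-/
lemma conj_eq_of_conj_eq {c : G} (hc : c ∈ Subgroup.centralizer {t}) (hcx : x * c * x = c) :
    y * c * y = c := by
  refine (h.conj_eq_or' hy hyC hc).resolve_right fun h1 => ?_
  obtain ⟨d, hd, w, hw, hwC, hwd, hact⟩ := h.exists_third hx hxC hy hyC hxy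
  have h2 := hact c hc
  have h3 : x * (c * zeta t y) * x = x * c * x * (x * zeta t y * x) := by
    simp only [mul_assoc, mul_mul_cancel_of_mem_sqOne hx]
  rw [h1, h3, hcx, h.conj_zeta hx hxC hy hyC hxy] at h2
  have h4 := h.conj_eq_or' hw hwC hc
  rw [h2, h.zeta_third hx hxC hy hyC hxy hact] at h4
  rcases h4 with h4 | h4
  · exact h.zeta_ne_one hy hyC (by simpa using h4)
  · exact h.zeta_ne_one hx hxC (by simpa using h4)

/-- Writing `x * y = d * w` with `w` an involution and `d ∈ C`, the square is `d * (w * d * w)`, and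
`w` multiplies `d` by 1 or `zeta t w`. -/
lemma mul_mul_self_eq_or :
    x * y * (x * y) = 1 ∨ x * y * (x * y) = zeta t x * zeta t y := by
  obtain ⟨d, hd, w, hw, hwC, hwd, hact⟩ := h.exists_third hx hxC hy hyC hxy
  have hds := h.mem_sqOne_of_mem d hd
  have h1 : x * y = d * w := by rw [hwd, mul_mul_cancel_of_mem_sqOne hds]
  have h2 : x * y * (x * y) = d * (w * d * w) := by rw [h1]; simp only [mul_assoc]
  rw [h2, ← h.zeta_third hx hxC hy hyC hxy hact]
  rcases h.conj_eq_or' hw hwC hd with h3 | h3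
  · left; rw [h3, mem_sqOne.1 hds]
  · right; rw [h3, mul_mul_cancel_of_mem_sqOne hds]

lemma natCard_closure_zeta_ge :
    4 ≤ Nat.card (Subgroup.closure {zeta t x, zeta t y}) := by
  have h1 := h.zeta_ne_one hx hxC
  have h2 := h.zeta_ne_one hy hyC
  have h3 := h.zeta_ne_zeta hx hy hxy
  have hxm : zeta t x ∈ Subgroup.closure {zeta t x, zeta t y} :=
    Subgroup.subset_closure (by simp)
  have hym : zeta t y ∈ Subgroup.closure {zeta t x, zeta t y} :=
    Subgroup.subset_closure (by simp)
  have hsub : ({1, zeta t x, zeta t y, zeta t x * zeta t y} : Set G) ⊆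
      (Subgroup.closure {zeta t x, zeta t y} : Subgroup G) := by
    rintro _ (rfl | rfl | rfl | rfl)
    · exact Subgroup.one_mem _
    · exact hxm
    · exact hym
    · exact Subgroup.mul_mem _ hxm hym
  have h4 := Set.ncard_le_ncard hsub (Set.toFinite _)
  have h5 : ({1, zeta t x, zeta t y, zeta t x * zeta t y} : Set G).ncard = 4 := by
    have h6 : zeta t x * zeta t y ≠ 1 := fun h6 => h3 <| by
      rw [← inv_eq_of_mem_sqOne (h.zeta_mem_sqOne hy hyC)]
      exact eq_inv_of_mul_eq_one_left h6
    rw [Set.ncard_insert_of_notMem, Set.ncard_insert_of_notMem, Set.ncard_pair]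
    · simpa using h1
    · simp [h3, h2]
    · simp [h1.symm, h2.symm, h6.symm]
  rw [h5] at h4
  exact h4

/-- `R` contains `C`, since `C` is generated by `t` and the centralizer of `x` in it. Thus `R`
contains three of the four cosets of `C`. -/
lemma closure_eq_top {R : Subgroup G} (ht : t ∈ R) (hxR : x ∈ R) (hyR : y ∈ R)
    (hR : Subgroup.centralizer {t} ⊓ Subgroup.centralizer {x} ≤ R) : R = ⊤ := by
  set C := Subgroup.centralizer {t} with hC
  have hCR : C ≤ R := fun c hc => by
    rcases h.commute_or_mul_commute hx hxC hc with h1 | h1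
    · exact hR ⟨hc, Subgroup.mem_centralizer_singleton_iff.2 h1⟩
    · exact (R.mul_mem_cancel_right ht).1 (hR ⟨C.mul_mem hc (mem_centralizer_self t),
        Subgroup.mem_centralizer_singleton_iff.2 h1⟩)
  have hsub : ((C : Set G) ∪ (· * x) '' (C : Set G)) ∪ (· * y) '' (C : Set G) ⊆ R := by
    rintro _ ((hc | ⟨c, hc, rfl⟩) | ⟨c, hc, rfl⟩)
    · exact hCR hc
    · exact R.mul_mem (hCR hc) hxR
    · exact R.mul_mem (hCR hc) hyR
  have hd1 : Disjoint (C : Set G) ((· * x) '' (C : Set G)) := by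
    rw [Set.disjoint_left]
    rintro _ hu ⟨c, hc, rfl⟩
    exact hxC ((C.mul_mem_cancel_left hc).1 hu)
  have hd2 : Disjoint ((C : Set G) ∪ (· * x) '' (C : Set G)) ((· * y) '' (C : Set G)) := by
    rw [Set.disjoint_left]
    rintro _ (hu | ⟨c, hc, rfl⟩) ⟨d, hd, h1⟩
    · subst h1
      exact hyC ((C.mul_mem_cancel_left hd).1 hu)
    · change d * y = c * x at h1
      refine hxy ?_
      have h2 : x = c⁻¹ * (d * y) := by rw [h1, inv_mul_cancel_left]
      rw [h2, mul_assoc, mul_assoc, mem_sqOne.1 hy, mul_one]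
      exact C.mul_mem (C.inv_mem hc) hd
  have h1 := Set.ncard_union_eq hd1 (Set.toFinite _) (Set.toFinite _)
  have h2 := Set.ncard_union_eq hd2 (Set.toFinite _) (Set.toFinite _)
  rw [Set.ncard_image_of_injective _ (mul_left_injective _)] at h1 h2
  have h3 := Set.ncard_le_ncard hsub (Set.toFinite _)
  have h4 : Nat.card G = 4 * Nat.card C := h.card
  have h5 : 0 < Nat.card C := Nat.card_pos
  apply eq_top_of_card_lt
  change _ < 2 * (R : Set G).ncard
  change Nat.card G = 4 * (C : Set G).ncard at h4
  change 0 < (C : Set G).ncard at h5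
  omega

/-- Here `|G| = 8 |Z|` and the subgroup generated by the two commutators has at least four elements,
which is where the bound 32 comes from. -/
lemma exists_mulEquiv_of_hom {P : Type*} [Group P] [Finite P] (hP : Nat.card P ≤ 32) (f : P →* G)
    (hf : ∀ H : Subgroup G, t ∈ H → x ∈ H → y ∈ H → f.range ≤ H) (htf : t ∈ f.range)
    (hxf : x ∈ f.range) (hyf : y ∈ f.range) : ∃ k : ℕ, Nonempty (G ≃* P × CycTwoPow k) := by
  have hcx : ∀ {u c : G}, u ∈ sqOne G → u * c * u = c → c * u = u * c := fun {u c} hu hc => by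
    nth_rw 1 [← hc]
    rw [mul_assoc, mem_sqOne.1 hu, mul_one]
  set Z := Subgroup.centralizer {t} ⊓ Subgroup.centralizer {x} with hZ
  have hW : ∀ H : Subgroup G, zeta t x ∈ H → zeta t y ∈ H →
      Subgroup.closure {zeta t x, zeta t y} ≤ H := fun H h1 h2 => by
    rw [Subgroup.closure_le]
    rintro _ (rfl | rfl)
    · exact h1
    · exact h2
  have hzr : ∀ u ∈ f.range, zeta t u ∈ f.range := fun u hu =>
    f.range.mul_mem htf (f.range.mul_mem (f.range.mul_mem hu htf) hu)
  refine exists_mulEquiv_prod (Z := Z) (W := Subgroup.closure {zeta t x, zeta t y}) f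
    (hW Z ?_ ?_) (hW _ (hzr x hxf) (hzr y hyf)) (fun c hc => h.mem_sqOne_of_mem c hc.1) ?_ ?_ ?_
  · exact ⟨h.zeta_mem hx hxC, Subgroup.mem_centralizer_singleton_iff.2
      (hcx hx (h.conj_zeta_self hx hxC))⟩
  · exact ⟨h.zeta_mem hy hyC, Subgroup.mem_centralizer_singleton_iff.2
      (hcx hx (h.conj_zeta hx hxC hy hyC hxy))⟩
  · intro p c hc
    have hct := Subgroup.mem_centralizer_singleton_iff.1 hc.1
    have hcx' := Subgroup.mem_centralizer_singleton_iff.1 hc.2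
    have hcy := hcx hy (h.conj_eq_of_conj_eq hx hxC hy hyC hxy hc.1
      (by rw [← hcx', mul_assoc, mem_sqOne.1 hx, mul_one]))
    exact Subgroup.mem_centralizer_singleton_iff.1 <| hf (Subgroup.centralizer {c})
      (Subgroup.mem_centralizer_singleton_iff.2 hct.symm)
      (Subgroup.mem_centralizer_singleton_iff.2 hcx'.symm)
      (Subgroup.mem_centralizer_singleton_iff.2 hcy.symm) ⟨p, rfl⟩
  · exact h.closure_eq_top hx hxC hy hyC hxy (Subgroup.mem_sup_left htf)
      (Subgroup.mem_sup_left hxf) (Subgroup.mem_sup_left hyf) le_sup_right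
  · have h1 := h.natCard_closure_zeta_ge hx hxC hy hyC hxy
    have h2 := h.card_eq hx hxC
    have h3 := h.card
    rw [h3, h2]
    calc Nat.card P * Nat.card Z ≤ 32 * Nat.card Z := Nat.mul_le_mul_right _ hP
      _ = 4 * (2 * Nat.card Z) * 4 := by ring
      _ ≤ _ := Nat.mul_le_mul_left _ h1

lemma exists_mulEquiv_sGroup (h1 : x * y * (x * y) = 1) :
    ∃ k : ℕ, Nonempty (G ≃* SGroup 2 × CycTwoPow k) := by
  have hyx := mul_notMem_comm hx hy hxy
  have hfin := finite_sGroup_two.1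
  have hcx : ∀ {u c : G}, u ∈ sqOne G → u * c * u = c → u * c = c * u := fun {u c} hu hc => by
    nth_rw 2 [← hc]
    rw [mul_assoc, mem_sqOne.1 hu, mul_one]
  have hxyc : x * y = y * x := commute_of_mul_mem_sqOne hx hy h1
  let v : SGen 2 → G
    | .c => t
    | .x i => ![x, y] i
    | .y i => ![zeta t x, zeta t y] i
  have hzx := h.zeta_mem hx hxC
  have hzy := h.zeta_mem hy hyC
  let f : SGroup 2 →* G := sGroupHom v
    (by
      rintro (_ | i | i)
      · exact h.mem
      · fin_cases i
        · exact hx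
        · exact hy
      · fin_cases i
        · exact h.zeta_mem_sqOne hx hxC
        · exact h.zeta_mem_sqOne hy hyC)
    (by intro i; fin_cases i <;> simp [v, zeta, mul_assoc])
    (by
      intro i
      fin_cases i
      · exact (Subgroup.mem_centralizer_singleton_iff.1 hzx).symm
      · exact (Subgroup.mem_centralizer_singleton_iff.1 hzy).symm)
    (by
      intro i j
      fin_cases i <;> fin_cases j
      · rfl
      · exact hxyc
      · exact hxyc.symm
      · rfl)
    (by
      intro i j
      fin_cases i <;> fin_cases j
      · exact hcx hx (h.conj_zeta_self hx hxC)
      · exact hcx hx (h.conj_zeta hx hxC hy hyC hxy)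
      · exact hcx hy (h.conj_zeta hy hyC hx hxC hyx)
      · exact hcx hy (h.conj_zeta_self hy hyC))
    (by
      intro i j
      fin_cases i <;> fin_cases j
      · rfl
      · exact h.mul_comm_of_mem hzx hzy
      · exact h.mul_comm_of_mem hzy hzx
      · rfl)
  have hfv : ∀ g, f (sGen g) = v g := fun g => PresentedGroup.toGroup.of _
  refine h.exists_mulEquiv_of_hom hx hxC hy hyC hxy finite_sGroup_two.2 f ?_ ⟨_, hfv .c⟩
    ⟨_, hfv (.x 0)⟩ ⟨_, hfv (.x 1)⟩
  rintro H htH hxH hyH _ ⟨g, rfl⟩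
  refine PresentedGroup.generated_by _ (H.comap f) ?_ g
  intro j
  change f (sGen j) ∈ H
  rw [hfv]
  rcases j with _ | i | i
  · exact htH
  · fin_cases i
    · exact hxH
    · exact hyH
  · fin_cases i
    · exact H.mul_mem htH (H.mul_mem (H.mul_mem hxH htH) hxH)
    · exact H.mul_mem htH (H.mul_mem (H.mul_mem hyH htH) hyH)

/-- The elements `t * x` and `t * y` have fourth power 1 and are inverted by `t`; the hypothesis
`h1` is what makes them commute. -/
lemma exists_mulEquiv_genDihedral (h1 : x * y * (x * y) = zeta t x * zeta t y) :
    ∃ k : ℕ, Nonempty (G ≃* GenDihedral (Cyc 4 × Cyc 4) × CycTwoPow k) := by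
  have h4 : ∀ u, u ∈ sqOne G → u ∉ Subgroup.centralizer {t} → (t * u) ^ 4 = 1 := fun u hu huC => by
    have h2 : (t * u) ^ 2 = zeta t u := by
      rw [zeta, pow_two]
      simp only [mul_assoc]
    rw [show 4 = 2 * 2 from rfl, pow_mul, h2, pow_two_of_mem_sqOne (h.zeta_mem_sqOne hu huC)]
  have hinv : ∀ u, u ∈ sqOne G → t * (t * u) * t⁻¹ = (t * u)⁻¹ := fun u hu => by
    rw [mul_mul_cancel_of_mem_sqOne h.mem, mul_inv_rev, inv_eq_of_mem_sqOne hu]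
  have hab : Commute (t * x) (t * y) := by
    have ha : t * x * t = zeta t x * x := by
      simp only [zeta, mul_assoc, mem_sqOne.1 hx, mul_one]
    have hb : t * y * t = zeta t y * y := by
      simp only [zeta, mul_assoc, mem_sqOne.1 hy, mul_one]
    have hc : x * y = zeta t x * zeta t y * (y * x) := by
      rw [← h1]
      simp only [mul_assoc, mul_mul_cancel_of_mem_sqOne hy, mem_sqOne.1 hx, mul_one]
    have hl : t * x * (t * y) = zeta t x * (x * y) := by
      rw [← mul_assoc, ha, mul_assoc]
    have hr : t * y * (t * x) = zeta t y * (y * x) := by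
      rw [← mul_assoc, hb, mul_assoc]
    rw [Commute, SemiconjBy, hl, hr, hc, mul_assoc,
      mul_mul_cancel_of_mem_sqOne (h.zeta_mem_sqOne hx hxC)]
  let α := cycHom (t * x) (h4 x hx hxC)
  let β := cycHom (t * y) (h4 y hy hyC)
  have hcomm : ∀ u v, Commute (α u) (β v) := fun u v => by
    obtain ⟨i, hi⟩ := exists_cycHom_eq (t * x) (h4 x hx hxC) u
    obtain ⟨j, hj⟩ := exists_cycHom_eq (t * y) (h4 y hy hyC) v
    change Commute (cycHom _ _ u) (cycHom _ _ v)
    rw [hi, hj]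
    exact (hab.zpow_left i).zpow_right j
  let φ := α.noncommCoprod β hcomm
  have hφ : ∀ u v, φ (u, v) = α u * β v := fun u v => rfl
  let f := genDihedralHom φ t h.mem <| by
    rintro ⟨u, v⟩
    rw [Prod.inv_mk, hφ, hφ, conj_mul]
    congr 1
    · exact conj_cycHom (h4 x hx hxC) (hinv x hx) u
    · exact conj_cycHom (h4 y hy hyC) (hinv y hy) v
  have hft : t ∈ f.range := ⟨_, genDihedralHom_inr _ _ _ _⟩
  have hfα : ∀ u, α u ∈ f.range := fun u => ⟨SemidirectProduct.inl (u, 1), by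
    rw [genDihedralHom_inl, hφ, map_one, mul_one]⟩
  have hfβ : ∀ u, β u ∈ f.range := fun u => ⟨SemidirectProduct.inl (1, u), by
    rw [genDihedralHom_inl, hφ, map_one, one_mul]⟩
  refine h.exists_mulEquiv_of_hom hx hxC hy hyC hxy ?_ f ?_ hft ?_ ?_
  · rw [natCard_genDihedral, Nat.card_prod]
    simp
  · rintro H htH hxH hyH _ ⟨g, rfl⟩
    rw [← SemidirectProduct.inl_left_mul_inr_right g, map_mul]
    refine H.mul_mem ?_ ?_
    · obtain ⟨u, v⟩ := g.left
      rw [genDihedralHom_inl, hφ]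
      obtain ⟨i, hi⟩ := exists_cycHom_eq (t * x) (h4 x hx hxC) u
      obtain ⟨j, hj⟩ := exists_cycHom_eq (t * y) (h4 y hy hyC) v
      change cycHom _ _ u * cycHom _ _ v ∈ H
      rw [hi, hj]
      exact H.mul_mem (H.zpow_mem (H.mul_mem htH hxH) i) (H.zpow_mem (H.mul_mem htH hyH) j)
    · rcases (by decide : ∀ u : Cyc 2, u = 1 ∨ u = Multiplicative.ofAdd 1) g.right with h2 | h2 <;>
        rw [h2]
      · rw [map_one, map_one]
        exact H.one_mem
      · rw [genDihedralHom_inr]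
        exact htH
  · refine (f.range.mul_mem_cancel_left hft).1 ?_
    rw [← cycHom_one (t * x) (h4 x hx hxC)]
    exact hfα _
  · refine (f.range.mul_mem_cancel_left hft).1 ?_
    rw [← cycHom_one (t * y) (h4 y hy hyC)]
    exact hfβ _

end two

theorem classification :
    (∃ k : ℕ, Nonempty (G ≃* GenDihedral (Cyc 4 × Cyc 4) × CycTwoPow k)) ∨
      ∃ k : ℕ, Nonempty (G ≃* SGroup 2 × CycTwoPow k) := by
  set C := Subgroup.centralizer {t} with hC
  have hcard : Nat.card G = 4 * (C : Set G).ncard := h.card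
  have hpos : 0 < (C : Set G).ncard := Nat.card_pos (α := C)
  obtain ⟨g, hg⟩ : ∃ g, g ∉ C := by
    by_contra! hall
    have h1 : C = ⊤ := eq_top_iff.2 fun g _ => hall g
    rw [h1, Subgroup.coe_top, Set.ncard_univ] at hcard
    rw [h1, Subgroup.coe_top, Set.ncard_univ] at hpos
    omega
  obtain ⟨c, hc, hx⟩ := h.exists_mul_mem_sqOne hg
  set x := c * g with hxdef
  have hxC : x ∉ C := fun h1 => hg ((C.mul_mem_cancel_left hc).1 h1)
  obtain ⟨g', hg'⟩ : ∃ g', g' ∉ (C : Set G) ∪ (· * x) '' (C : Set G) := by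
    by_contra! hall
    have h1 := Set.ncard_union_le (C : Set G) ((· * x) '' (C : Set G))
    rw [Set.eq_univ_of_forall hall, Set.ncard_univ,
      Set.ncard_image_of_injective _ (mul_left_injective _)] at h1
    omega
  have hg1 : g' ∉ C := fun h1 => hg' (Or.inl h1)
  obtain ⟨d, hd, hy⟩ := h.exists_mul_mem_sqOne hg1
  set y := d * g' with hydef
  have hyC : y ∉ C := fun h1 => hg1 ((C.mul_mem_cancel_left hd).1 h1)
  have hyx : y * x ∉ C := fun h1 => hg' <| Or.inr ⟨d⁻¹ * (y * x), C.mul_mem (C.inv_mem hd) h1, by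
    change d⁻¹ * (y * x) * x = g'
    rw [mul_assoc, mul_assoc, mem_sqOne.1 hx, mul_one, hydef, inv_mul_cancel_left]⟩
  rcases h.mul_mul_self_eq_or hy hyC hx hxC hyx with h1 | h1
  · exact Or.inr (h.exists_mulEquiv_sGroup hy hyC hx hxC hyx h1)
  · exact Or.inl (h.exists_mulEquiv_genDihedral hy hyC hx hxC hyx h1)

end IsNormalIndexFour

end indexFour

/-! ### From the average order to the density of involutions -/

section main

variable {G : Type*} [Group G]

lemma pow_two_pow_succ_le_orderOf (hG : IsPGroup 2 G) {x : G} {i : ℕ} (hx : x ^ 2 ^ i ≠ 1) :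
    2 ^ (i + 1) ≤ orderOf x := by
  obtain ⟨j, hj⟩ := IsPGroup.iff_orderOf.1 hG x
  rw [hj]
  refine Nat.pow_le_pow_right (by norm_num) ?_
  by_contra! h
  refine hx (orderOf_dvd_iff_pow_eq_one.1 ?_)
  rw [hj]
  exact Nat.pow_dvd_pow 2 (by omega)

/-- A lower bound for the sum of the element orders of a finite `2`-group. -/
lemma four_mul_card_le_sum_orderOf [Fintype G] (hG : IsPGroup 2 G) :
    4 * Nat.card G + 4 * {x : G | x ^ 4 ≠ 1}.ncard ≤
      (∑ x : G, orderOf x) + 2 * (sqOne G).ncard + 1 := by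
  classical
  -- The last term corrects the identity, whose order is 1 rather than 2.
  have hpt : ∀ x : G, 4 + 4 * (if x ^ 4 ≠ 1 then 1 else 0) ≤
      orderOf x + 2 * (if x ∈ sqOne G then 1 else 0) + if x = 1 then 1 else 0 := by
    intro x
    by_cases h1 : x = 1
    · subst h1
      simp [mem_sqOne]
    by_cases h2 : x ∈ sqOne G
    · have h3 : x ^ 4 = 1 := by
        rw [show 4 = 2 * 2 from rfl, pow_mul, pow_two_of_mem_sqOne h2, one_pow]
      have h4 := pow_two_pow_succ_le_orderOf hG (x := x) (i := 0) (by simpa using h1)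
      simp [h1, h2, h3]
      omega
    by_cases h3 : x ^ 4 = 1
    · have h4 := pow_two_pow_succ_le_orderOf hG (x := x) (i := 1)
        (by rw [pow_one, pow_two]; exact h2)
      simp [h1, h2, h3]
      omega
    · have h4 := pow_two_pow_succ_le_orderOf hG (x := x) (i := 2) h3
      simp [h1, h2, h3]
      omega
  have hsum := Finset.sum_le_sum fun x (_ : x ∈ Finset.univ) => hpt x
  have hS : ∀ (p : G → Prop) [DecidablePred p],
      ∑ x, (if p x then 1 else 0) = {x | p x}.ncard := fun p _ => by
    rw [Finset.sum_boole, Set.ncard_eq_toFinset_card']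
    simp
  simp only [Finset.sum_add_distrib, ← Finset.mul_sum, hS] at hsum
  simpa [Set.ofPred_mem_eq, mul_comm] using hsum

lemma five_mul_sum_orderOf_lt [Fintype G] (ho : avgOrder G < 2.8) :
    5 * ∑ x : G, orderOf x < 14 * Nat.card G := by
  have hpos : (0 : ℚ) < (Fintype.card G : ℚ) := by exact_mod_cast Fintype.card_pos
  rw [avgOrder, div_lt_iff₀ hpos] at ho
  rw [Nat.card_eq_fintype_card]
  have : (5 * ∑ x : G, (orderOf x : ℚ)) < 14 * (Fintype.card G : ℚ) := by linarith
  exact_mod_cast this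

lemma exists_mulEquiv_cycTwoPow [Finite G] (h : ∀ x : G, x ∈ sqOne G) :
    ∃ k : ℕ, Nonempty (G ≃* CycTwoPow k) := by
  obtain ⟨k, ⟨e⟩⟩ := exists_mulEquiv_prod (P := Unit) (Z := (⊤ : Subgroup G)) (W := ⊥) 1
    bot_le bot_le (fun x _ => h x) (by simp) (by simp) (by simp)
  exact ⟨k, ⟨e.trans MulEquiv.uniqueProd⟩⟩

lemma mulEquiv_cyc_four [Finite G] (hG : IsPGroup 2 G) (hc : Nat.card G = 4) {x : G}
    (hx : x ∉ sqOne G) : Nonempty (G ≃* Cyc 4) := by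
  have h1 := pow_two_pow_succ_le_orderOf hG (x := x) (i := 1)
    (by rwa [pow_one, pow_two])
  have h2 : orderOf x = Nat.card G := le_antisymm (orderOf_le_card) (by omega)
  have h3 : IsCyclic G := isCyclic_of_orderOf_eq_card x h2
  exact ⟨(zmodCyclicMulEquiv h3).symm.trans (by rw [hc])⟩

end main

end AverageOrder

end

theorem mainTheorem3 {G : Type*} [Group G] [Fintype G]
    (hG : IsPGroup 2 G) (ho : AverageOrder.avgOrder G < 2.8) :
    Nonempty (G ≃* AverageOrder.Cyc 4) ∨
    (∃ k : ℕ, Nonempty (G ≃* DihedralGroup 4 × AverageOrder.CycTwoPow k)) ∨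
    (∃ k : ℕ, Nonempty
      (G ≃* AverageOrder.GenDihedral (AverageOrder.Cyc 4 × AverageOrder.Cyc 4) ×
        AverageOrder.CycTwoPow k)) ∨
    (∃ k : ℕ, Nonempty (G ≃* AverageOrder.D8CentralD8 × AverageOrder.CycTwoPow k)) ∨
    (∃ k : ℕ, Nonempty (G ≃* AverageOrder.SGroup 2 × AverageOrder.CycTwoPow k)) ∨
    (∃ k : ℕ, Nonempty (G ≃* AverageOrder.CycTwoPow k)) := by
  open AverageOrder in
  by_cases hsq : ∀ x : G, x ∈ sqOne G
  · have := exists_mulEquiv_cycTwoPow hsq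
    tauto
  have hsum := five_mul_sum_orderOf_lt ho
  have hord := four_mul_card_le_sum_orderOf hG
  obtain ⟨n, hn⟩ := IsPGroup.iff_card.1 hG
  by_cases hI : 16 * (sqOne G).ncard ≤ 9 * Nat.card G
  · left
    push Not at hsq
    obtain ⟨x, hx⟩ := hsq
    -- The bounds give `6/5 |G| < 2 |I| + 1 ≤ 9/8 |G| + 1`, so `|G| < 40/3`.
    have hle : Nat.card G ≤ 13 := by omega
    have h1 : 1 < Nat.card G := Finite.one_lt_card_iff_nontrivial.2
      ⟨x, 1, fun h => hx (by rw [h]; exact mul_one 1)⟩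
    refine mulEquiv_cyc_four hG ?_ hx
    have hn4 : n < 4 := by
      by_contra! h
      have := Nat.pow_le_pow_right (show 0 < 2 by norm_num) h
      omega
    interval_cases n
    · omega
    · exact absurd (by
        have h2 := orderOf_dvd_natCard x
        rw [hn] at h2
        rw [mem_sqOne, ← pow_two]
        exact orderOf_dvd_iff_pow_eq_one.1 h2) hx
    · exact hn
    -- For order 8, `hI` allows at most four elements of square one, too few for `hsum` and `hord`.
    · omega
  push Not at hI
  by_cases hi : ∀ s ∈ sqOne G, (Subgroup.centralizer {s}).index ≤ 2
  · obtain ⟨z, hz⟩ := exists_isClassTwo (by omega) hi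
    rcases hz.classification hI with h | h | h
    · exact absurd h hsq
    · exact Or.inr (Or.inl h)
    · exact Or.inr (Or.inr (Or.inr (Or.inl h)))
  push Not at hi
  obtain ⟨t, ht, hti⟩ := hi
  have hcard : Nat.card G = 4 * Nat.card (Subgroup.centralizer {t}) := by
    have h1 := two_mul_ncard_sqOne_add_card_centralizer_le ht
    have h2 := ncard_inter_sqOne_le_card (Subgroup.centralizer {t})
    have h3 := (Subgroup.centralizer {t}).card_mul_index
    obtain ⟨m, hm⟩ := hG.index (Subgroup.centralizer {t})
    rw [hm] at h3 hti
    -- Index at least 8 would give `|I| ≤ (|G| + |C|) / 2 ≤ 9/16 |G|`.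
    have h4 : m < 3 := by
      by_contra! h
      have h5 := Nat.pow_le_pow_right (show 0 < 2 by norm_num) h
      have h6 := Nat.mul_le_mul_left (Nat.card (Subgroup.centralizer {t})) h5
      omega
    interval_cases m <;> omega
  have hF : IsIndexFour t := ⟨ht, hcard, hI⟩
  -- Otherwise at least `|G| / 8` elements have nontrivial fourth power, while `|I| ≤ 5/8 |G|`; the
  -- order sum is then at least `13/4 |G| - 1`, too large since `|G| ≥ 4`.
  have hN : IsNormalIndexFour t := ⟨hF, fun x hx hxC => by
    by_contra hxt
    have h1 := hF.exists_many_pow_four_ne hx hxC hxt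
    have h2 := hF.two_mul_ncard_le
    have h3 : 0 < Nat.card (Subgroup.centralizer {t}) := Nat.card_pos
    omega⟩
  rcases hN.classification with h | h
  · exact Or.inr (Or.inr (Or.inl h))
  · exact Or.inr (Or.inr (Or.inr (Or.inr (Or.inl h))))
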